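/- Let $n\ge 3$, let $M$ be a compact smooth $n$-dimensional manifold with (possibly empty) smooth boundary $\partial M$, and let $g$ be a smooth Riemannian metric on $M$ with conformal class $[g]=\{e^{2\omega}g:\omega\in C^\infty(M)\}$. For a smooth metric $\hat g$ on $M$ let $R_{\hat g}$ be its scalar curvature on $M$ and $h_{\hat g}$ the mean curvature of $\partial M$, i.e. the trace of the second fundamental form with respect to the outward unit normal $\nu$ (so that $h=n-1$ for the Euclidean unit ball), and put $\mathcal R(\hat g)=(R_{\hat g},h_{\hat g})$. Let $\Delta_g=-\operatorname{div}_g\nabla_g$ be the positive Laplacian and let $$P_{1,g}=\Delta_g+\frac{n-2}{4(n-1)}R_g\ \text{ on } M,\qquad B_g=\partial_\nu+\frac{n-2}{2(n-1)}h_g\ \text{ on } \partial M .$$ Denote by $\ker P^R_{1,g}$ the set of all $u\in C^\infty(M)$ with $P_{1,g}u=0$ on $M$ and $B_gu=0$ on $\partial M$. Two pairs $(Q,f)$ and $(Q',f')$ of real functions on $M$ and on $\partial M$ are said to have the same strict sign if $Q(x)$ and $Q'(x)$ have the same sign ($+$, $-$ or $0$) at every $x\in M$, and $f(y)$ and $f'(y)$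 have the same sign at every $y\in\partial M$; they are said to have opposite strict sign if $(Q,f)$ and $(-Q',-f')$ have the same strict sign. Let $u\in\ker P^R_{1,g}$ with $u\not\equiv 0$. Then: (1) there is no metric $\hat g\in[g]$ with $\mathcal R(\hat g)=(u,u|_{\partial M})$; (2) more generally, if a pair $(Q,f)$ of real functions on $M$ and on $\partial M$ has the same or the opposite strict sign as $(u,u|_{\partial M})$, then there is no metric $\hat g\in[g]$ with $\mathcal R(\hat g)=(Q,f)$. -/

import Mathlib

open scoped Manifold ContDiff Topology

noncomputable section

namespace ConfBdry

/-! ### Local Riemannian geometry in a half-space chart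

A metric in coordinates is a matrix-valued function `G` on `ℝⁿ`; only its values on the half-space
`{y | 0 ≤ y 0}` matter, and all derivatives are taken within this half-space, so that they make
sense up to the boundary `y 0 = 0`. -/

section Local

variable {n : ℕ} [NeZero n]

/-- The closed half-space `{y ∈ ℝⁿ | 0 ≤ y 0}`. -/
def halfSpace (n : ℕ) [NeZero n] : Set (EuclideanSpace ℝ (Fin n)) := {y | 0 ≤ y 0}

/-- The `i`-th coordinate vector of `ℝⁿ`. -/
def coordVec (i : Fin n) : EuclideanSpace ℝ (Fin n) := EuclideanSpace.single i 1

/-- The partial derivative `∂ᵢ f` on the half-space. -/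
def pderiv (i : Fin n) (f : EuclideanSpace ℝ (Fin n) → ℝ) (y : EuclideanSpace ℝ (Fin n)) : ℝ :=
  fderivWithin ℝ f (halfSpace n) y (coordVec i)

/-- The Christoffel symbols
`Γᵏᵢⱼ = ½ gᵏˡ (∂ᵢ gⱼₗ + ∂ⱼ gᵢₗ - ∂ₗ gᵢⱼ)`. -/
def christoffel (G : EuclideanSpace ℝ (Fin n) → Matrix (Fin n) (Fin n) ℝ) (k i j : Fin n)
    (y : EuclideanSpace ℝ (Fin n)) : ℝ :=
  (1 / 2) * ∑ l, (G y)⁻¹ k l *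
    (pderiv i (fun z => G z j l) y + pderiv j (fun z => G z i l) y - pderiv l (fun z => G z i j) y)

/-- The Ricci tensor
`Ricᵢⱼ = ∂ₖ Γᵏᵢⱼ - ∂ⱼ Γᵏᵢₖ + Γᵏₖₗ Γˡᵢⱼ - Γᵏⱼₗ Γˡᵢₖ`. -/
def ricci (G : EuclideanSpace ℝ (Fin n) → Matrix (Fin n) (Fin n) ℝ) (i j : Fin n)
    (y : EuclideanSpace ℝ (Fin n)) : ℝ :=
  ∑ k, (pderiv k (christoffel G k i j) y - pderiv j (christoffel G k i k) y
    + ∑ l, (christoffel G k k l y * christoffel G l i j y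
      - christoffel G k j l y * christoffel G l i k y))

/-- The scalar curvature `gⁱʲ Ricᵢⱼ` (positive for round spheres). -/
def scalar (G : EuclideanSpace ℝ (Fin n) → Matrix (Fin n) (Fin n) ℝ)
    (y : EuclideanSpace ℝ (Fin n)) : ℝ :=
  ∑ i, ∑ j, (G y)⁻¹ i j * ricci G i j y

/-- The positive Laplacian `Δ f = -div grad f = -gⁱʲ (∂ᵢ ∂ⱼ f - Γᵏᵢⱼ ∂ₖ f)`. -/
def laplace (G : EuclideanSpace ℝ (Fin n) → Matrix (Fin n) (Fin n) ℝ)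
    (f : EuclideanSpace ℝ (Fin n) → ℝ) (y : EuclideanSpace ℝ (Fin n)) : ℝ :=
  -∑ i, ∑ j, (G y)⁻¹ i j *
    (pderiv i (pderiv j f) y - ∑ k, christoffel G k i j y * pderiv k f y)

/-- The components of the outward unit normal `ν = -grad y⁰ / |grad y⁰|`, that is
`νⁱ = -gⁱ⁰ / √g⁰⁰`, to the boundary `y 0 = 0` of the half-space. -/
def normal (G : EuclideanSpace ℝ (Fin n) → Matrix (Fin n) (Fin n) ℝ)
    (y : EuclideanSpace ℝ (Fin n)) (i : Fin n) : ℝ :=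
  -(G y)⁻¹ i 0 / Real.sqrt ((G y)⁻¹ 0 0)

/-- The outward normal derivative `∂_ν f = νⁱ ∂ᵢ f`. -/
def normalDeriv (G : EuclideanSpace ℝ (Fin n) → Matrix (Fin n) (Fin n) ℝ)
    (f : EuclideanSpace ℝ (Fin n) → ℝ) (y : EuclideanSpace ℝ (Fin n)) : ℝ :=
  ∑ i, normal G y i * pderiv i f y

/-- The second fundamental form
`II(∂ₐ, ∂_b) = g(∇_{∂ₐ} ν, ∂_b) = -g(ν, ∇_{∂ₐ} ∂_b) = -g_{kl} νᵏ Γˡ_{ab}` of the boundary with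
respect to the outward unit normal; here `∂ₐ`, `∂_b` with `a, b ≠ 0` are the coordinate fields
tangent to the boundary. -/
def secondFundForm (G : EuclideanSpace ℝ (Fin n) → Matrix (Fin n) (Fin n) ℝ)
    (y : EuclideanSpace ℝ (Fin n)) (a b : {i : Fin n // i ≠ 0}) : ℝ :=
  -∑ k, ∑ l, G y k l * normal G y k * christoffel G l a b y

/-- The metric induced on the boundary, in the tangential coordinates `yᵃ`, `a ≠ 0`. -/
def inducedMetric (G : EuclideanSpace ℝ (Fin n) → Matrix (Fin n) (Fin n) ℝ)
    (y : EuclideanSpace ℝ (Fin n)) : Matrix {i : Fin n // i ≠ 0} {i : Fin n // i ≠ 0} ℝ :=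
  Matrix.of fun a b => G y a b

/-- The mean curvature of the boundary, the trace of the second fundamental form with respect to
the induced metric (equal to `n - 1` for the boundary of the Euclidean unit ball). -/
def mean (G : EuclideanSpace ℝ (Fin n) → Matrix (Fin n) (Fin n) ℝ)
    (y : EuclideanSpace ℝ (Fin n)) : ℝ :=
  ∑ a, ∑ b, (inducedMetric G y)⁻¹ a b * secondFundForm G y a b

end Local

/-! ### Manifolds with boundary

Curvatures and differential operators at a point `x` are computed in the preferred chart at `x`;
by tensoriality any other chart around `x` gives the same value. -/

section Global

variable (n : ℕ) [NeZero n] (M : Type*) [TopologicalSpace M]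
  [ChartedSpace (EuclideanHalfSpace n) M] [IsManifold (𝓡∂ n) ∞ M]

/-- Smooth Riemannian metrics on the manifold with boundary `M`. -/
abbrev Metric : Type _ :=
  Bundle.ContMDiffRiemannianMetric (𝓡∂ n) ∞ (EuclideanSpace ℝ (Fin n))
    (fun x : M => TangentSpace (𝓡∂ n) x)

/-- Smooth real functions on `M` (smooth up to the boundary). -/
abbrev SmoothFun : Type _ := C^∞⟮𝓡∂ n, M; 𝓘(ℝ, ℝ), ℝ⟯

/-- The boundary `∂M`. -/
abbrev Bdry : Set M := (𝓡∂ n).boundary M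

variable {n M}

/-- The coordinates of `x` in the preferred chart at `x`. -/
def coord (x : M) : EuclideanSpace ℝ (Fin n) := extChartAt (𝓡∂ n) x x

/-- The coordinate vector field `∂ᵢ` of the preferred chart at `x`, at the point of `M` with
coordinates `y`: the image of the `i`-th basis vector under the differential of the inverse
chart. -/
def chartVec (x : M) (i : Fin n) (y : EuclideanSpace ℝ (Fin n)) :
    TangentSpace (𝓡∂ n) ((extChartAt (𝓡∂ n) x).symm y) :=
  mfderivWithin 𝓘(ℝ, EuclideanSpace ℝ (Fin n)) (𝓡∂ n) (extChartAt (𝓡∂ n) x).symm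
    (halfSpace n) y (coordVec i : EuclideanSpace ℝ (Fin n))

/-- The matrix `gᵢⱼ = g(∂ᵢ, ∂ⱼ)` of the metric in the preferred chart at `x`. -/
def gram (g : Metric n M) (x : M) (y : EuclideanSpace ℝ (Fin n)) : Matrix (Fin n) (Fin n) ℝ :=
  Matrix.of fun i j =>
    g.inner ((extChartAt (𝓡∂ n) x).symm y) (chartVec x i y) (chartVec x j y)

/-- The function `u` read in the preferred chart at `x`. -/
def inChart (u : M → ℝ) (x : M) (y : EuclideanSpace ℝ (Fin n)) : ℝ :=
  u ((extChartAt (𝓡∂ n) x).symm y)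

/-- The scalar curvature `R_g : M → ℝ`. -/
def scalarCurvature (g : Metric n M) (x : M) : ℝ := scalar (gram g x) (coord x)

/-- The mean curvature `h_g : ∂M → ℝ` of the boundary. -/
def meanCurvature (g : Metric n M) (x : Bdry n M) : ℝ := mean (gram g x.1) (coord x.1)

/-- The positive Laplace-Beltrami operator `Δ_g`. -/
def laplaceBeltrami (g : Metric n M) (u : M → ℝ) (x : M) : ℝ :=
  laplace (gram g x) (inChart u x) (coord x)

/-- The outward unit normal derivative `∂_ν u : ∂M → ℝ`. -/
def outwardNormalDeriv (g : Metric n M) (u : M → ℝ) (x : Bdry n M) : ℝ :=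
  normalDeriv (gram g x.1) (inChart u x.1) (coord x.1)

/-- The conformal Laplacian `P_{1,g} = Δ_g + (n-2)/(4(n-1)) R_g`. -/
def conformalLaplacian (g : Metric n M) (u : M → ℝ) (x : M) : ℝ :=
  laplaceBeltrami g u x + ((n : ℝ) - 2) / (4 * ((n : ℝ) - 1)) * scalarCurvature g x * u x

/-- The conformal Robin boundary operator `B_g = ∂_ν + (n-2)/(2(n-1)) h_g`. -/
def robinOperator (g : Metric n M) (u : M → ℝ) (x : Bdry n M) : ℝ :=
  outwardNormalDeriv g u x + ((n : ℝ) - 2) / (2 * ((n : ℝ) - 1)) * meanCurvature g x * u x.1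

/-- The kernel of the conformal Laplacian with conformal Robin boundary condition:
smooth `u` with `P_{1,g} u = 0` on `M` and `B_g u = 0` on `∂M`. -/
def robinKernel (g : Metric n M) : Set (SmoothFun n M) :=
  {u | (∀ x : M, conformalLaplacian g u x = 0) ∧ ∀ x : Bdry n M, robinOperator g u x = 0}

/-- The conformal class `[g] = {e^{2ω} g | ω ∈ C^∞(M)}`. -/
def conformalClass (g : Metric n M) : Set (Metric n M) :=
  {g' | ∃ w : SmoothFun n M, ∀ (x : M) (X Y : TangentSpace (𝓡∂ n) x),
    g'.inner x X Y = Real.exp (2 * w x) * g.inner x X Y}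

/-- The curvature map `g ↦ (R_g, h_g)`. -/
def curvatureMap (g : Metric n M) : (M → ℝ) × (Bdry n M → ℝ) :=
  (scalarCurvature g, meanCurvature g)

/-- The pair `(u, u|_{∂M})`. -/
def withTrace (u : M → ℝ) : (M → ℝ) × (Bdry n M → ℝ) := (u, fun x => u x.1)

/-- Two pairs have the same strict sign: at every point both first components are positive, or both
are negative, or both are zero, and likewise for the second components. -/
def SameStrictSign {X Y : Type*} (p q : (X → ℝ) × (Y → ℝ)) : Prop :=
  (∀ x, SignType.sign (p.1 x) = SignType.sign (q.1 x)) ∧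
    ∀ y, SignType.sign (p.2 y) = SignType.sign (q.2 y)

/-- Two pairs have opposite strict sign. -/
def OppositeStrictSign {X Y : Type*} (p q : (X → ℝ) × (Y → ℝ)) : Prop :=
  SameStrictSign p (-q)

end Global

end ConfBdry

end

/-!
Suppose that `g' = e^{2w} g` has scalar curvature `R'` and mean curvature `h'` whose signs are
everywhere those of `u`, or everywhere those of `-u`, where `P_g u = 0` and `B_g u = 0`. By
conformal covariance (`MetricNear.conformalLaplacian_conformal`,
`MetricNear.robinOperator_conformal`) the function `v = s e^{-(n-2)w/2} u`, with `s = -1` for equal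
and `s = 1` for opposite signs, satisfies `P_{g'} v = 0` and `B_{g'} v = 0`, that is
`Δ' v = -c R' v` on `M` and `∂_ν v = -2 c h' v` on `∂M` with `c = (n-2)/(4(n-1)) > 0`. By the choice
of `s` both right-hand sides are positive where `v ≠ 0` and zero where `v = 0`
(`strictlySuperharmonic_of_sign_eq`). Instead of integrating the first equation over `M`, which
would need the divergence theorem, the proof uses the maximum principle.

The function `v` has no local minimum at a point where it does not vanish: at an interior minimum
the positive Laplacian is nonpositive, and at a boundary minimum the outward normal derivative is
nonpositive. As `M` is compact, `v ≥ 0`. The set of zeros of `v` is open by the strong maximum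
principle, which follows from the Hopf lemma (`hopf`) in a chart; at a zero on the boundary Hopf's
lemma applies directly, since there `v` has a minimum and `∂_ν v = 0`, so that `dv = 0`. Thus
`{v ≠ 0}` is compact and open. If it is nonempty, the minimum of `v` over it is a local minimum at
which `v` does not vanish, a contradiction. So `v = 0` and `u = 0`
(`StrictlySuperharmonic.eq_zero`). In particular `M` need not be connected.

The curvatures and the Laplacian are given at each point by the classical formulas in the preferred
chart at this point. The conformal transformation laws only compare two metrics in the same chart,
but the strong maximum principle needs the Laplacian of `v` at all points of one chart. Hence the
invariance of the Laplacian under changes of coordinates is proved as well (`laplace_comp`), from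
the transformation law of the Christoffel symbols. Boundary points are avoided there: the Hopf lemma
uses the sign of the Laplacian in the open half-space only.
-/

noncomputable section

namespace ConfBdry

/-! ### Calculus on the half-space -/

section Calculus

variable {n : ℕ} [NeZero n]

lemma uniqueDiffOn_halfSpace : UniqueDiffOn ℝ (halfSpace n) := by
  have h := (𝓡∂ n).uniqueDiffOn
  rwa [range_modelWithCornersEuclideanHalfSpace] at h

lemma pderiv_congr {f f' : EuclideanSpace ℝ (Fin n) → ℝ} {y : EuclideanSpace ℝ (Fin n)}
    (hy : y ∈ halfSpace n)
    (h : f =ᶠ[𝓝[halfSpace n] y] f') (i : Fin n) : pderiv i f y = pderiv i f' y := by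
  unfold pderiv
  rw [h.fderivWithin_eq (h.self_of_nhdsWithin hy)]

lemma pderiv_congr_eventually {f f' : EuclideanSpace ℝ (Fin n) → ℝ} {y : EuclideanSpace ℝ (Fin n)}
    (h : f =ᶠ[𝓝[halfSpace n] y] f') (i : Fin n) :
    pderiv i f =ᶠ[𝓝[halfSpace n] y] pderiv i f' := by
  have h1 := eventually_eventually_nhdsWithin.2 h
  filter_upwards [h1, self_mem_nhdsWithin] with z hz hz'
  exact pderiv_congr hz' hz i

/-- `f` is smooth, up to the boundary of the half-space, at all points of the half-space near
`y`. Requiring this at all nearby points, and not only at `y`, makes the property stable under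
`pderiv`. -/
def SmoothNear (f : EuclideanSpace ℝ (Fin n) → ℝ) (y : EuclideanSpace ℝ (Fin n)) : Prop :=
  ∀ᶠ z in 𝓝[halfSpace n] y, ContDiffWithinAt ℝ ∞ f (halfSpace n) z

namespace SmoothNear

variable {f f' : EuclideanSpace ℝ (Fin n) → ℝ} {y : EuclideanSpace ℝ (Fin n)}

lemma eventually (h : SmoothNear f y) : ∀ᶠ z in 𝓝[halfSpace n] y, SmoothNear f z :=
  eventually_eventually_nhdsWithin.2 h

lemma differentiableWithinAt (h : SmoothNear f y) (hy : y ∈ halfSpace n) :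
    DifferentiableWithinAt ℝ f (halfSpace n) y :=
  (h.self_of_nhdsWithin hy).differentiableWithinAt (by simp)

lemma continuousWithinAt (h : SmoothNear f y) (hy : y ∈ halfSpace n) :
    ContinuousWithinAt f (halfSpace n) y :=
  (h.self_of_nhdsWithin hy).continuousWithinAt

lemma congr (h : SmoothNear f y) (h' : f' =ᶠ[𝓝[halfSpace n] y] f) : SmoothNear f' y := by
  filter_upwards [h, eventually_eventually_nhdsWithin.2 h', self_mem_nhdsWithin] with z hz hz' hzH
  exact hz.congr_of_eventuallyEq hz' (hz'.self_of_nhdsWithin hzH)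

lemma const (c : ℝ) : SmoothNear (fun _ : EuclideanSpace ℝ (Fin n) => c) y :=
  Filter.Eventually.of_forall fun _ => contDiffWithinAt_const

lemma add (h : SmoothNear f y) (h' : SmoothNear f' y) : SmoothNear (fun z => f z + f' z) y := by
  filter_upwards [h, h'] with z hz hz' using hz.add hz'

lemma sub (h : SmoothNear f y) (h' : SmoothNear f' y) : SmoothNear (fun z => f z - f' z) y := by
  filter_upwards [h, h'] with z hz hz' using hz.sub hz'

lemma mul (h : SmoothNear f y) (h' : SmoothNear f' y) : SmoothNear (fun z => f z * f' z) y := by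
  filter_upwards [h, h'] with z hz hz' using hz.mul hz'

lemma const_mul (c : ℝ) (h : SmoothNear f y) : SmoothNear (fun z => c * f z) y :=
  (const c).mul h

lemma neg (h : SmoothNear f y) : SmoothNear (fun z => -f z) y := by
  filter_upwards [h] with z hz using hz.neg

lemma exp (h : SmoothNear f y) : SmoothNear (fun z => Real.exp (f z)) y := by
  filter_upwards [h] with z hz using hz.exp

lemma sum {ι : Type*} (s : Finset ι) {F : ι → EuclideanSpace ℝ (Fin n) → ℝ}
    (h : ∀ i, SmoothNear (F i) y) :
    SmoothNear (fun z => ∑ i ∈ s, F i z) y := by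
  induction s using Finset.cons_induction with
  | empty => simpa using const 0
  | cons a s ha ih => simpa only [Finset.sum_cons] using (h a).add ih

lemma prod {ι : Type*} (s : Finset ι) {F : ι → EuclideanSpace ℝ (Fin n) → ℝ}
    (h : ∀ i, SmoothNear (F i) y) :
    SmoothNear (fun z => ∏ i ∈ s, F i z) y := by
  induction s using Finset.cons_induction with
  | empty => simpa using const 1
  | cons a s ha ih => simpa only [Finset.prod_cons] using (h a).mul ih

lemma det {ι : Type*} [Fintype ι] [DecidableEq ι]
    {A : EuclideanSpace ℝ (Fin n) → Matrix ι ι ℝ} (h : ∀ i j, SmoothNear (fun z => A z i j) y) :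
    SmoothNear (fun z => (A z).det) y := by
  simp only [Matrix.det_apply']
  exact SmoothNear.sum _ fun σ => (SmoothNear.prod _ fun i => h _ _).const_mul _

lemma pderiv (h : SmoothNear f y) (i : Fin n) : SmoothNear (pderiv i f) y := by
  filter_upwards [h, self_mem_nhdsWithin] with z hz hz'
  exact (hz.fderivWithin_right uniqueDiffOn_halfSpace (m := ∞) (by simp) hz').clm_apply
    contDiffWithinAt_const

end SmoothNear

section Rules

variable {f f' : EuclideanSpace ℝ (Fin n) → ℝ} {y : EuclideanSpace ℝ (Fin n)}

@[simp] lemma pderiv_const (c : ℝ) (i : Fin n) :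
    pderiv i (fun _ : EuclideanSpace ℝ (Fin n) => c) y = 0 := by
  simp [pderiv]

lemma pderiv_add (hy : y ∈ halfSpace n) (h : SmoothNear f y) (h' : SmoothNear f' y) (i : Fin n) :
    pderiv i (fun z => f z + f' z) y = pderiv i f y + pderiv i f' y := by
  unfold pderiv
  rw [fderivWithin_fun_add (uniqueDiffOn_halfSpace y hy) (h.differentiableWithinAt hy)
    (h'.differentiableWithinAt hy)]
  rfl

lemma pderiv_sub (hy : y ∈ halfSpace n) (h : SmoothNear f y) (h' : SmoothNear f' y) (i : Fin n) :
    pderiv i (fun z => f z - f' z) y = pderiv i f y - pderiv i f' y := by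
  unfold pderiv
  rw [fderivWithin_fun_sub (uniqueDiffOn_halfSpace y hy) (h.differentiableWithinAt hy)
    (h'.differentiableWithinAt hy)]
  rfl

lemma pderiv_mul (hy : y ∈ halfSpace n) (h : SmoothNear f y) (h' : SmoothNear f' y) (i : Fin n) :
    pderiv i (fun z => f z * f' z) y = f y * pderiv i f' y + pderiv i f y * f' y := by
  unfold pderiv
  rw [fderivWithin_fun_mul (uniqueDiffOn_halfSpace y hy) (h.differentiableWithinAt hy)
    (h'.differentiableWithinAt hy)]
  simp [mul_comm]

lemma pderiv_const_mul (hy : y ∈ halfSpace n) (c : ℝ) (h : SmoothNear f y) (i : Fin n) :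
    pderiv i (fun z => c * f z) y = c * pderiv i f y := by
  rw [pderiv_mul hy (SmoothNear.const c) h]
  simp

lemma pderiv_exp (hy : y ∈ halfSpace n) (h : SmoothNear f y) (i : Fin n) :
    pderiv i (fun z => Real.exp (f z)) y = Real.exp (f y) * pderiv i f y := by
  unfold pderiv
  rw [fderivWithin_exp (h.differentiableWithinAt hy) (uniqueDiffOn_halfSpace y hy)]
  rfl

lemma pderiv_sum {ι : Type*} (s : Finset ι) {F : ι → EuclideanSpace ℝ (Fin n) → ℝ}
    (hy : y ∈ halfSpace n)
    (h : ∀ i, SmoothNear (F i) y) (i : Fin n) :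
    pderiv i (fun z => ∑ a ∈ s, F a z) y = ∑ a ∈ s, pderiv i (F a) y := by
  induction s using Finset.cons_induction with
  | empty => simp
  | cons a s ha ih =>
    simp only [Finset.sum_cons]
    rw [pderiv_add hy (h a) (SmoothNear.sum s h), ih]

end Rules

/-! ### Smooth metrics in coordinates -/

/-- `G` is a smooth Riemannian metric at all points of the half-space near `y`. -/
structure MetricNear (G : EuclideanSpace ℝ (Fin n) → Matrix (Fin n) (Fin n) ℝ)
    (y : EuclideanSpace ℝ (Fin n)) : Prop where
  smooth : ∀ i j, SmoothNear (fun z => G z i j) y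
  posDef : ∀ᶠ z in 𝓝[halfSpace n] y, (G z).PosDef

namespace MetricNear

variable {G : EuclideanSpace ℝ (Fin n) → Matrix (Fin n) (Fin n) ℝ} {y : EuclideanSpace ℝ (Fin n)}

lemma eventually (h : MetricNear G y) : ∀ᶠ z in 𝓝[halfSpace n] y, MetricNear G z := by
  have h1 : ∀ᶠ z in 𝓝[halfSpace n] y, ∀ i j, SmoothNear (fun z => G z i j) z := by
    rw [Filter.eventually_all]
    intro i
    rw [Filter.eventually_all]
    exact fun j => (h.smooth i j).eventually
  filter_upwards [h1, eventually_eventually_nhdsWithin.2 h.posDef] with z h1 h2 using ⟨h1, h2⟩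

lemma posDef_self (h : MetricNear G y) (hy : y ∈ halfSpace n) : (G y).PosDef :=
  h.posDef.self_of_nhdsWithin hy

lemma isUnit_det (h : MetricNear G y) (hy : y ∈ halfSpace n) : IsUnit (G y).det :=
  ((h.posDef_self hy).det_pos.ne').isUnit

lemma symm (h : MetricNear G y) (hy : y ∈ halfSpace n) (i j : Fin n) : G y i j = G y j i := by
  simpa using (h.posDef_self hy).1.apply j i

lemma inv_symm (h : MetricNear G y) (hy : y ∈ halfSpace n) (i j : Fin n) :
    (G y)⁻¹ i j = (G y)⁻¹ j i := by
  simpa using (h.posDef_self hy).inv.1.apply j i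

lemma symm_eventually (h : MetricNear G y) (i j : Fin n) :
    (fun z => G z i j) =ᶠ[𝓝[halfSpace n] y] fun z => G z j i := by
  filter_upwards [h.posDef] with z hz
  simpa using hz.1.apply j i

lemma pderiv_symm (h : MetricNear G y) (hy : y ∈ halfSpace n) (k i j : Fin n) :
    pderiv k (fun z => G z i j) y = pderiv k (fun z => G z j i) y :=
  pderiv_congr hy (h.symm_eventually i j) k

lemma sum_inv_mul (h : MetricNear G y) (hy : y ∈ halfSpace n) (i j : Fin n) :
    ∑ k, (G y)⁻¹ i k * G y k j = if i = j then 1 else 0 := by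
  rw [← Matrix.mul_apply, Matrix.nonsing_inv_mul _ (h.isUnit_det hy), Matrix.one_apply]

lemma sum_mul_inv (h : MetricNear G y) (hy : y ∈ halfSpace n) (i j : Fin n) :
    ∑ k, G y i k * (G y)⁻¹ k j = if i = j then 1 else 0 := by
  rw [← Matrix.mul_apply, Matrix.mul_nonsing_inv _ (h.isUnit_det hy), Matrix.one_apply]

lemma smooth_inv (h : MetricNear G y) (i j : Fin n) : SmoothNear (fun z => (G z)⁻¹ i j) y := by
  have hadj : SmoothNear (fun z => (G z).adjugate i j) y := by
    simp only [Matrix.adjugate_apply]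
    refine SmoothNear.det fun a b => ?_
    by_cases hb : a = j
    · subst hb
      simpa using SmoothNear.const _
    · simpa [Matrix.updateRow_ne hb] using h.smooth a b
  have hdet : SmoothNear (fun z => ((G z).det)⁻¹) y := by
    filter_upwards [SmoothNear.det h.smooth, h.posDef] with z hz hz'
    exact hz.inv hz'.det_pos.ne'
  refine (hdet.mul hadj).congr (Filter.Eventually.of_forall fun z => ?_)
  simp [Matrix.inv_def]

lemma smooth_christoffel (h : MetricNear G y) (k i j : Fin n) :
    SmoothNear (christoffel G k i j) y :=
  (SmoothNear.sum _ fun l => (h.smooth_inv k l).mul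
    ((((h.smooth j l).pderiv i).add ((h.smooth i l).pderiv j)).sub
      ((h.smooth i j).pderiv l))).const_mul _

/-- The Levi-Civita connection is torsion free. -/
lemma christoffel_symm (h : MetricNear G y) (hy : y ∈ halfSpace n) (k i j : Fin n) :
    christoffel G k i j y = christoffel G k j i y := by
  unfold christoffel
  congr 1
  refine Finset.sum_congr rfl fun l _ => ?_
  rw [h.pderiv_symm hy l i j]
  ring

/-- The Christoffel symbols with lowered index. -/
lemma sum_metric_mul_christoffel (h : MetricNear G y) (hy : y ∈ halfSpace n) (m i j : Fin n) :
    ∑ k, G y m k * christoffel G k i j y =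
      (1 / 2) * (pderiv i (fun z => G z j m) y + pderiv j (fun z => G z i m) y
        - pderiv m (fun z => G z i j) y) := by
  have h1 : ∀ F : Fin n → ℝ, ∑ k, G y m k * ((1 / 2) * ∑ l, (G y)⁻¹ k l * F l)
      = (1 / 2) * F m := by
    intro F
    calc ∑ k, G y m k * ((1 / 2) * ∑ l, (G y)⁻¹ k l * F l)
        = ∑ k, ∑ l, (1 / 2) * F l * (G y m k * (G y)⁻¹ k l) := by
          refine Finset.sum_congr rfl fun k _ => ?_
          rw [Finset.mul_sum, Finset.mul_sum]
          exact Finset.sum_congr rfl fun l _ => by ring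
      _ = ∑ l, (1 / 2) * F l * ∑ k, G y m k * (G y)⁻¹ k l := by
          rw [Finset.sum_comm]
          exact Finset.sum_congr rfl fun l _ => by rw [Finset.mul_sum]
      _ = (1 / 2) * F m := by
          simp [h.sum_mul_inv hy]
  exact h1 _

/-- Compatibility of the Levi-Civita connection with the metric. -/
lemma pderiv_metric (h : MetricNear G y) (hy : y ∈ halfSpace n) (k i j : Fin n) :
    pderiv k (fun z => G z i j) y =
      ∑ a, G y i a * christoffel G a k j y + ∑ a, G y j a * christoffel G a k i y := by
  rw [h.sum_metric_mul_christoffel hy, h.sum_metric_mul_christoffel hy,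
    h.pderiv_symm hy k j i]
  ring

end MetricNear

end Calculus

/-! ### The conformal change of the Ricci tensor: index algebra at a point -/

section IndexAlgebra

variable {ι : Type*} [Fintype ι] [DecidableEq ι]

/-- The difference `δᵏᵢ θⱼ + δᵏⱼ θᵢ - gᵢⱼ Vᵏ` between the Christoffel symbols of `e^{2w} g` and
those of `g`, where `θ = dw` and `V = grad w`. -/
def conformalDiff (g : ι → ι → ℝ) (θ V : ι → ℝ) (k i j : ι) : ℝ :=
  (if k = i then θ j else 0) + (if k = j then θ i else 0) - g i j * V k

variable {g ginv : ι → ι → ℝ} {θ V : ι → ℝ}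

/-- The contraction `Dᵏⱼₗ Xˡₖ` for `D = conformalDiff g θ V`; in the conformal change of the Ricci
tensor it occurs with `Γˡᵢₖ` and `Dˡᵢₖ` in place of `Xˡₖ`. -/
lemma sum_conformalDiff_mul (X : ι → ι → ℝ) (j : ι) :
    ∑ k, ∑ l, conformalDiff g θ V k j l * X l k =
      ∑ l, θ l * X l j + θ j * ∑ k, X k k - ∑ k, ∑ l, g j l * V k * X l k := by
  simp only [conformalDiff, add_mul, sub_mul, Finset.sum_add_distrib, Finset.sum_sub_distrib,
    ite_mul, zero_mul, Finset.sum_ite_eq, Finset.mem_univ, if_true, Finset.mul_sum]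
  congr 2
  rw [Finset.sum_comm]
  simp

lemma sum_conformalDiff_diag (hV : ∀ l, ∑ k, g l k * V k = θ l) (hg : ∀ i j, g i j = g j i)
    (l : ι) : ∑ k, conformalDiff g θ V k k l = Fintype.card ι * θ l := by
  have h : ∑ k, g k l * V k = θ l := by simp_rw [hg _ l, hV]
  simp [conformalDiff, Finset.sum_add_distrib, Finset.sum_sub_distrib, h]

lemma conformalDiff_symm {κ : Type*} [DecidableEq κ] {g : κ → κ → ℝ} {θ V : κ → ℝ}
    (hg : ∀ i j, g i j = g j i) (k i j : κ) :
    conformalDiff g θ V k i j = conformalDiff g θ V k j i := by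
  unfold conformalDiff
  rw [hg i j]
  ring

lemma trace_conformalDiff (hgi : ∀ i j, ginv i j = ginv j i) (hg : ∀ i j, g i j = g j i)
    (hinv : ∀ i j, ∑ k, ginv i k * g k j = if i = j then 1 else 0)
    (hθ : ∀ k, ∑ l, ginv k l * θ l = V k) (k : ι) :
    ∑ i, ∑ j, ginv i j * conformalDiff g θ V k i j = (2 - Fintype.card ι) * V k := by
  have h1 : ∑ i, ∑ j, ginv i j * g i j = Fintype.card ι := by
    have : ∀ i, ∑ j, ginv i j * g i j = 1 := fun i => by
      simp_rw [hg i _, hinv i i, if_true]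
    simp [this]
  have h2 : ∑ i, ∑ j, ginv i j * (if k = i then θ j else 0) = V k := by
    rw [Finset.sum_comm]
    simp [hθ]
  have h3 : ∑ i, ∑ j, ginv i j * (if k = j then θ i else 0) = V k := by
    simp [hgi _ k, hθ]
  have h4 : ∑ i, ∑ j, ginv i j * (g i j * V k) = Fintype.card ι * V k := by
    rw [← h1, Finset.sum_mul]
    simp_rw [Finset.sum_mul, mul_assoc]
  simp only [conformalDiff, mul_sub, mul_add, Finset.sum_add_distrib, Finset.sum_sub_distrib,
    h2, h3, h4]
  ring

lemma sum_sum_mul_const {κ : Type*} [Fintype κ] (c : ℝ) (A B : κ → κ → ℝ) :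
    ∑ i, ∑ j, A i j * (c * B i j) = c * ∑ i, ∑ j, A i j * B i j := by
  simp_rw [Finset.mul_sum]
  exact Finset.sum_congr rfl fun i _ => Finset.sum_congr rfl fun j _ => by ring

/-- The quadratic term `Dᵏⱼₗ Dˡᵢₖ` in the conformal change of the Ricci tensor. -/
lemma sum_conformalDiff_mul_self (hV : ∀ l, ∑ k, g l k * V k = θ l)
    (hg : ∀ i j, g i j = g j i) (i j : ι) :
    ∑ k, ∑ l, conformalDiff g θ V k j l * conformalDiff g θ V l i k =
      (Fintype.card ι + 2) * (θ i * θ j) - 2 * (g i j * ∑ l, θ l * V l) := by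
  have h1 : ∑ l, θ l * conformalDiff g θ V l i j
      = 2 * (θ i * θ j) - g i j * ∑ l, θ l * V l := by
    have e : ∑ l, θ l * (g i j * V l) = g i j * ∑ l, θ l * V l := by
      rw [Finset.mul_sum]
      exact Finset.sum_congr rfl fun l _ => by ring
    simp only [conformalDiff, mul_sub, mul_add, Finset.sum_add_distrib, Finset.sum_sub_distrib,
      mul_ite, mul_zero, Finset.sum_ite_eq', Finset.mem_univ, if_true, e]
    ring
  have h2 : ∑ k, conformalDiff g θ V k i k = Fintype.card ι * θ i := by
    simp_rw [conformalDiff_symm hg _ i]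
    exact sum_conformalDiff_diag hV hg i
  have h3 : ∑ k, ∑ l, g j l * V k * conformalDiff g θ V l i k = g i j * ∑ l, θ l * V l := by
    have e1 : ∀ k, ∑ l, g j l * V k * conformalDiff g θ V l i k
        = g j i * (θ k * V k) + θ i * (g j k * V k) - θ j * (g i k * V k) := by
      intro k
      have e : ∑ l, g j l * V k * (g i k * V l) = (g i k * V k) * ∑ l, g j l * V l := by
        rw [Finset.mul_sum]
        exact Finset.sum_congr rfl fun l _ => by ring
      simp only [conformalDiff, mul_sub, mul_add, Finset.sum_add_distrib, Finset.sum_sub_distrib,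
        mul_ite, mul_zero, Finset.sum_ite_eq', Finset.mem_univ, if_true, e, hV]
      ring
    simp only [e1, Finset.sum_add_distrib, Finset.sum_sub_distrib, ← Finset.mul_sum, hV]
    rw [hg j i]
    ring
  rw [sum_conformalDiff_mul, h1, h2, h3]
  ring

/-- The conformal change of the scalar curvature, as an identity between the values at one point of
the tensors involved: `H` is the coordinate Hessian of `w`, `dV` and `dg` are the first derivatives
of `V = grad w` and of the metric, and `Γ` are the Christoffel symbols. -/
lemma trace_ricci_conformalDiff {Γ dg : ι → ι → ι → ℝ} {H dV : ι → ι → ℝ}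
    (hgi : ∀ i j, ginv i j = ginv j i) (hg : ∀ i j, g i j = g j i)
    (hinv : ∀ i j, ∑ k, ginv i k * g k j = if i = j then 1 else 0)
    (hθ : ∀ k, ∑ l, ginv k l * θ l = V k) (hV : ∀ l, ∑ k, g l k * V k = θ l)
    (hΓ : ∀ k i j, Γ k i j = Γ k j i)
    (hH : ∀ k l, H k l = ∑ m, (g l m * dV k m + dg k l m * V m))
    (hdg : ∀ k i j, dg k i j = ∑ a, g i a * Γ a k j + ∑ a, g j a * Γ a k i) :
    ∑ i, ∑ j, ginv i j * ∑ k,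
      (((if k = i then H k j else 0) + (if k = j then H k i else 0)
          - (g i j * dV k k + dg k i j * V k))
        - ((if k = i then H j k else 0) + (if k = k then H j i else 0)
          - (g i k * dV j k + dg j i k * V k))
        + ∑ l, ((conformalDiff g θ V k k l * Γ l i j + Γ k k l * conformalDiff g θ V l i j
            + conformalDiff g θ V k k l * conformalDiff g θ V l i j)
          - (conformalDiff g θ V k j l * Γ l i k + Γ k j l * conformalDiff g θ V l i k
            + conformalDiff g θ V k j l * conformalDiff g θ V l i k)))
    = -2 * (Fintype.card ι - 1) * ∑ i, ∑ j, ginv i j * (H i j - ∑ k, Γ k i j * θ k)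
      - (Fintype.card ι - 1) * (Fintype.card ι - 2) * ∑ l, θ l * V l := by
  -- the contractions in terms of which everything is expressed
  set N : ℝ := (Fintype.card ι : ℝ) with hN
  set D := conformalDiff g θ V with hD
  set W := ∑ l, θ l * V l with hW
  set trH := ∑ i, ∑ j, ginv i j * H i j with htrH
  set P := ∑ k, (∑ m, Γ m m k) * V k with hP
  set Q := ∑ i, ∑ j, ginv i j * ∑ k, Γ k i j * θ k with hQ
  have contr : ∀ X : ι → ι → ℝ, ∑ i, ∑ j, ginv i j * ∑ a, g j a * X i a = ∑ i, X i i := by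
    intro X
    refine Finset.sum_congr rfl fun i _ => ?_
    calc ∑ j, ginv i j * ∑ a, g j a * X i a = ∑ j, ∑ a, ginv i j * g j a * X i a := by
          simp_rw [Finset.mul_sum, mul_assoc]
      _ = ∑ a, (∑ j, ginv i j * g j a) * X i a := by
          rw [Finset.sum_comm]
          simp_rw [Finset.sum_mul]
      _ = X i i := by simp [hinv]
  have swap : ∀ X : ι → ι → ℝ, ∑ i, ∑ j, ginv i j * X j i = ∑ i, ∑ j, ginv i j * X i j := by
    intro X
    rw [Finset.sum_comm]
    exact Finset.sum_congr rfl fun i _ => Finset.sum_congr rfl fun j _ => by rw [hgi]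
  have contr' : ∀ X : ι → ι → ℝ, ∑ i, ∑ j, ginv i j * ∑ a, g i a * X j a = ∑ i, X i i :=
    fun X => (swap fun i j => ∑ a, g j a * X i a).trans (contr X)
  have hΓV : ∑ i, ∑ k, Γ i i k * V k = P := by
    rw [Finset.sum_comm]
    simp_rw [hP, Finset.sum_mul]
  have hWg : ∑ i, ∑ j, ginv i j * (θ i * θ j) = W := by
    refine Finset.sum_congr rfl fun i _ => ?_
    rw [← hθ i, Finset.mul_sum]
    exact Finset.sum_congr rfl fun j _ => by ring
  have hgg : ∑ i, ∑ j, ginv i j * g i j = N := by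
    have : ∀ i, ∑ j, ginv i j * g i j = 1 := fun i => by
      simp_rw [hg i _, hinv i i, if_true]
    simp [this, hN]
  have hdgV : ∑ i, ∑ j, ginv i j * ∑ k, dg k i j * V k = 2 * P := by
    have e : ∀ i j, ∑ k, dg k i j * V k = ∑ a, g i a * ∑ k, Γ a j k * V k
        + ∑ a, g j a * ∑ k, Γ a i k * V k := by
      intro i j
      simp_rw [hdg, add_mul, Finset.sum_add_distrib, Finset.sum_mul, Finset.mul_sum]
      congr 1 <;> rw [Finset.sum_comm] <;>
        exact Finset.sum_congr rfl fun a _ => Finset.sum_congr rfl fun k _ => by rw [hΓ a k]; ring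
    simp_rw [e, mul_add, Finset.sum_add_distrib]
    rw [contr fun i a => ∑ k, Γ a i k * V k, contr' fun j a => ∑ k, Γ a j k * V k, hΓV]
    ring
  have hdgV' : ∑ i, ∑ j, ginv i j * ∑ m, dg i j m * V m = P + Q := by
    have e : ∀ i j, ∑ m, dg i j m * V m = ∑ a, g j a * ∑ m, Γ a i m * V m
        + ∑ a, Γ a i j * θ a := by
      intro i j
      simp_rw [hdg, add_mul, Finset.sum_add_distrib, Finset.sum_mul, Finset.mul_sum]
      congr 1
      · rw [Finset.sum_comm]
        exact Finset.sum_congr rfl fun a _ => Finset.sum_congr rfl fun k _ => by ring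
      · rw [Finset.sum_comm]
        refine Finset.sum_congr rfl fun a _ => ?_
        rw [← hV a, Finset.mul_sum]
        exact Finset.sum_congr rfl fun k _ => by rw [hg k a]; ring
    simp_rw [e, mul_add, Finset.sum_add_distrib]
    rw [contr fun i a => ∑ k, Γ a i k * V k, hΓV]
  have hdiv : ∑ k, dV k k = trH - P - Q := by
    have : trH = ∑ k, dV k k + (P + Q) := by
      rw [← hdgV', ← contr dV, htrH]
      simp_rw [hH, Finset.sum_add_distrib, mul_add, Finset.sum_add_distrib]
    rw [this]
    ring
  have hγθ : ∑ i, ∑ j, ginv i j * (θ j * ∑ k, Γ k i k) = P := by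
    refine Finset.sum_congr rfl fun i _ => ?_
    rw [← hθ i, Finset.mul_sum]
    refine Finset.sum_congr rfl fun j _ => ?_
    simp_rw [fun k => hΓ k i k]
    ring
  have hF : ∑ i, ∑ j, ginv i j * ∑ k, ∑ l, D k j l * Γ l i k = Q := by
    have e : ∀ i j, ∑ k, ∑ l, D k j l * Γ l i k = ∑ k, Γ k i j * θ k + θ j * ∑ k, Γ k i k
        - ∑ a, g j a * ∑ k, Γ a i k * V k := by
      intro i j
      have e1 : ∑ a, g j a * ∑ k, Γ a i k * V k = ∑ k, ∑ a, g j a * V k * Γ a i k := by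
        rw [Finset.sum_comm]
        simp_rw [Finset.mul_sum]
        exact Finset.sum_congr rfl fun a _ => Finset.sum_congr rfl fun k _ => by ring
      rw [hD, sum_conformalDiff_mul fun l k => Γ l i k, e1]
      simp_rw [mul_comm (θ _) (Γ _ _ _)]
    simp_rw [e, mul_sub, mul_add, Finset.sum_sub_distrib, Finset.sum_add_distrib]
    rw [contr fun i a => ∑ k, Γ a i k * V k, hΓV, hγθ]
    ring
  have hG : ∑ i, ∑ j, ginv i j * ∑ k, ∑ l, Γ k j l * D l i k = Q := by
    rw [← hF, ← swap]
    refine Finset.sum_congr rfl fun i _ => Finset.sum_congr rfl fun j _ => ?_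
    rw [Finset.sum_comm]
    congr 1
    exact Finset.sum_congr rfl fun k _ => Finset.sum_congr rfl fun l _ => mul_comm _ _
  have key : ∀ i j, ∑ k,
      (((if k = i then H k j else 0) + (if k = j then H k i else 0)
          - (g i j * dV k k + dg k i j * V k))
        - ((if k = i then H j k else 0) + (if k = k then H j i else 0)
          - (g i k * dV j k + dg j i k * V k))
        + ∑ l, ((D k k l * Γ l i j + Γ k k l * D l i j + D k k l * D l i j)
          - (D k j l * Γ l i k + Γ k j l * D l i k + D k j l * D l i k)))
      = H i j + H j i - g i j * (∑ k, dV k k) - ∑ k, dg k i j * V k - N * H j i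
        + N * ∑ k, Γ k i j * θ k + ∑ l, ((∑ m, Γ m m l) + N * θ l) * D l i j
        - ∑ k, ∑ l, D k j l * Γ l i k - ∑ k, ∑ l, Γ k j l * D l i k
        - ((N + 2) * (θ i * θ j) - 2 * (g i j * W)) := by
    intro i j
    rw [← sum_conformalDiff_mul_self hV hg i j]
    have e1 : ∀ l, ∑ k, D k k l = N * θ l := sum_conformalDiff_diag hV hg
    have e2 : ∀ X : ι → ℝ, ∑ k, ∑ l, D k k l * X l = ∑ l, N * θ l * X l := fun X => by
      rw [Finset.sum_comm]
      simp_rw [← Finset.sum_mul, e1]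
    have e3 : ∑ k, ∑ l, Γ k k l * D l i j = ∑ l, (∑ m, Γ m m l) * D l i j := by
      rw [Finset.sum_comm]
      simp_rw [← Finset.sum_mul]
    have e4 : N * ∑ k, Γ k i j * θ k = ∑ l, N * θ l * Γ l i j := by
      rw [Finset.mul_sum]
      exact Finset.sum_congr rfl fun k _ => by ring
    simp only [Finset.sum_add_distrib, Finset.sum_sub_distrib, e2, e3, e4, add_mul,
      ← Finset.mul_sum]
    have e5 : H j i = ∑ k, (g i k * dV j k + dg j i k * V k) := hH j i
    rw [Finset.sum_add_distrib] at e5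
    simp only [Finset.sum_ite_eq', Finset.mem_univ, if_true, Finset.sum_const, Finset.card_univ,
      nsmul_eq_mul, ← hN]
    linear_combination -e5
  have hE : ∑ i, ∑ j, ginv i j * ∑ l, ((∑ m, Γ m m l) + N * θ l) * D l i j
      = (2 - N) * P + N * (2 - N) * W := by
    have e : ∑ i, ∑ j, ginv i j * ∑ l, ((∑ m, Γ m m l) + N * θ l) * D l i j
        = ∑ l, ((∑ m, Γ m m l) + N * θ l) * ∑ i, ∑ j, ginv i j * D l i j := by
      simp_rw [Finset.mul_sum]
      rw [Finset.sum_comm_cycle]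
      exact Finset.sum_congr rfl fun i _ => Finset.sum_congr rfl fun j _ =>
        Finset.sum_congr rfl fun k _ => by ring
    rw [e]
    simp_rw [hD, trace_conformalDiff hgi hg hinv hθ, hP, hW, Finset.mul_sum]
    rw [← Finset.sum_add_distrib]
    exact Finset.sum_congr rfl fun l _ => by ring
  have c1 : ∀ (c : ℝ) (X : ι → ι → ℝ),
      ∑ i, ∑ j, ginv i j * (c * X i j) = c * ∑ i, ∑ j, ginv i j * X i j :=
    fun c X => sum_sum_mul_const c _ X
  have c2 : ∀ (c : ℝ) (X : ι → ι → ℝ),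
      ∑ i, ∑ j, ginv i j * (X i j * c) = c * ∑ i, ∑ j, ginv i j * X i j := fun c X => by
    rw [← c1]
    simp_rw [mul_comm c]
  refine (Finset.sum_congr rfl fun i _ => Finset.sum_congr rfl fun j _ =>
    congrArg (ginv i j * ·) (key i j)).trans ?_
  simp only [mul_sub, mul_add, Finset.sum_sub_distrib, Finset.sum_add_distrib]
  have hs : ∑ i, ∑ j, ginv i j * H j i = trH := swap H
  rw [hE, c2, c1, c1, c1, c1, c2, hdgV, hF, hG, hWg, hgg, hs, hdiv, ← htrH, ← hQ]
  ring

end IndexAlgebra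

/-! ### Conformal change of metric in coordinates -/

section ConformalChange

variable {n : ℕ} [NeZero n]

/-- The conformal metric `e^{2w} G`. -/
def conformalMetric (w : EuclideanSpace ℝ (Fin n) → ℝ)
    (G : EuclideanSpace ℝ (Fin n) → Matrix (Fin n) (Fin n) ℝ) (z : EuclideanSpace ℝ (Fin n)) :
    Matrix (Fin n) (Fin n) ℝ :=
  Real.exp (2 * w z) • G z

/-- The `k`-th component `gᵏˡ ∂ₗ w` of the gradient of `w`. -/
def gradient (G : EuclideanSpace ℝ (Fin n) → Matrix (Fin n) (Fin n) ℝ)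
    (w : EuclideanSpace ℝ (Fin n) → ℝ) (k : Fin n) (z : EuclideanSpace ℝ (Fin n)) : ℝ :=
  ∑ l, (G z)⁻¹ k l * pderiv l w z

lemma inv_exp_smul {ι : Type*} [Fintype ι] [DecidableEq ι] (a : ℝ) {A : Matrix ι ι ℝ}
    (hA : IsUnit A.det) : (Real.exp a • A)⁻¹ = Real.exp (-a) • A⁻¹ := by
  refine Matrix.inv_eq_right_inv ?_
  rw [Matrix.smul_mul, Matrix.mul_smul, smul_smul, ← Real.exp_add, add_neg_cancel, Real.exp_zero,
    one_smul, Matrix.mul_nonsing_inv _ hA]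

variable {G : EuclideanSpace ℝ (Fin n) → Matrix (Fin n) (Fin n) ℝ}
  {w u : EuclideanSpace ℝ (Fin n) → ℝ} {y : EuclideanSpace ℝ (Fin n)}

lemma MetricNear.conformal (hG : MetricNear G y) (hw : SmoothNear w y) :
    MetricNear (conformalMetric w G) y where
  smooth i j := ((hw.const_mul 2).exp).mul (hG.smooth i j)
  posDef := by
    filter_upwards [hG.posDef] with z hz using hz.smul (Real.exp_pos _)

lemma MetricNear.smooth_gradient (hG : MetricNear G y) (hw : SmoothNear w y) (k : Fin n) :
    SmoothNear (gradient G w k) y :=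
  SmoothNear.sum _ fun l => (hG.smooth_inv k l).mul (hw.pderiv l)

lemma MetricNear.sum_mul_gradient (hG : MetricNear G y) (hy : y ∈ halfSpace n) (l : Fin n) :
    ∑ k, G y l k * gradient G w k y = pderiv l w y := by
  simp_rw [gradient, Finset.mul_sum]
  rw [Finset.sum_comm]
  simp_rw [← mul_assoc, ← Finset.sum_mul, hG.sum_mul_inv hy]
  simp

lemma MetricNear.inv_conformal (hG : MetricNear G y) (hy : y ∈ halfSpace n) (i j : Fin n) :
    (conformalMetric w G y)⁻¹ i j = Real.exp (-(2 * w y)) * (G y)⁻¹ i j := by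
  rw [conformalMetric, inv_exp_smul _ (hG.isUnit_det hy)]
  rfl

/-- The Christoffel symbols of `e^{2w} g`. -/
lemma MetricNear.christoffel_conformal (hG : MetricNear G y) (hw : SmoothNear w y)
    (hy : y ∈ halfSpace n) (k i j : Fin n) :
    christoffel (conformalMetric w G) k i j y = christoffel G k i j y +
      conformalDiff (G y) (fun i => pderiv i w y) (fun k => gradient G w k y) k i j := by
  have hd : ∀ a b c, pderiv a (fun z => conformalMetric w G z b c) y =
      Real.exp (2 * w y) * (pderiv a (fun z => G z b c) y + 2 * pderiv a w y * G y b c) := by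
    intro a b c
    have := pderiv_mul hy (hw.const_mul 2).exp (hG.smooth b c) a
    rw [pderiv_exp hy (hw.const_mul 2), pderiv_const_mul hy 2 hw] at this
    refine this.trans ?_
    ring
  have he : Real.exp (-(2 * w y)) * Real.exp (2 * w y) = 1 := by
    rw [← Real.exp_add]; simp
  have h1 : ∀ j, ∑ l, (G y)⁻¹ k l * G y j l = if k = j then 1 else 0 := fun j => by
    simp_rw [hG.symm hy j, hG.sum_inv_mul hy]
  have h2 : ∀ l, Real.exp (-(2 * w y)) * (G y)⁻¹ k l *
      (Real.exp (2 * w y) * (pderiv i (fun z => G z j l) y + 2 * pderiv i w y * G y j l)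
        + Real.exp (2 * w y) * (pderiv j (fun z => G z i l) y + 2 * pderiv j w y * G y i l)
        - Real.exp (2 * w y) * (pderiv l (fun z => G z i j) y + 2 * pderiv l w y * G y i j))
      = (G y)⁻¹ k l * (pderiv i (fun z => G z j l) y + pderiv j (fun z => G z i l) y
          - pderiv l (fun z => G z i j) y)
        + 2 * (pderiv i w y * ((G y)⁻¹ k l * G y j l) + pderiv j w y * ((G y)⁻¹ k l * G y i l)
          - G y i j * ((G y)⁻¹ k l * pderiv l w y)) := by
    intro l
    linear_combination ((G y)⁻¹ k l *
      ((pderiv i (fun z => G z j l) y + 2 * pderiv i w y * G y j l)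
        + (pderiv j (fun z => G z i l) y + 2 * pderiv j w y * G y i l)
        - (pderiv l (fun z => G z i j) y + 2 * pderiv l w y * G y i j))) * he
  simp only [christoffel, conformalDiff, gradient, hd, hG.inv_conformal hy, h2,
    Finset.sum_add_distrib, Finset.sum_sub_distrib, ← Finset.mul_sum, h1]
  rw [mul_add]
  split_ifs <;> ring

lemma MetricNear.pderiv_christoffel_conformal (hG : MetricNear G y) (hw : SmoothNear w y)
    (hy : y ∈ halfSpace n) (m k i j : Fin n) :
    pderiv m (christoffel (conformalMetric w G) k i j) y = pderiv m (christoffel G k i j) y +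
      ((if k = i then pderiv m (pderiv j w) y else 0)
        + (if k = j then pderiv m (pderiv i w) y else 0)
        - (G y i j * pderiv m (gradient G w k) y
          + pderiv m (fun z => G z i j) y * gradient G w k y)) := by
  have hite : ∀ (a b c : Fin n), SmoothNear (fun z => if a = b then pderiv c w z else 0) y := by
    intro a b c
    split_ifs
    · exact hw.pderiv c
    · exact SmoothNear.const 0
  have hite' : ∀ (a b c : Fin n), pderiv m (fun z => if a = b then pderiv c w z else 0) y
      = if a = b then pderiv m (pderiv c w) y else 0 := by
    intro a b c
    split_ifs
    · rfl
    · simp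
  have hev : christoffel (conformalMetric w G) k i j =ᶠ[𝓝[halfSpace n] y] fun z =>
      christoffel G k i j z + (((if k = i then pderiv j w z else 0)
        + (if k = j then pderiv i w z else 0)) - G z i j * gradient G w k z) := by
    filter_upwards [hG.eventually, hw.eventually, self_mem_nhdsWithin] with z h1 h2 h3
    exact h1.christoffel_conformal h2 h3 k i j
  rw [pderiv_congr hy hev, pderiv_add hy (hG.smooth_christoffel k i j)
    (((hite k i j).add (hite k j i)).sub ((hG.smooth i j).mul (hG.smooth_gradient hw k))),
    pderiv_sub hy ((hite k i j).add (hite k j i)) ((hG.smooth i j).mul (hG.smooth_gradient hw k)),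
    pderiv_add hy (hite k i j) (hite k j i), pderiv_mul hy (hG.smooth i j)
    (hG.smooth_gradient hw k), hite', hite']

/-- `R_{e^{2w} g} = e^{-2w} (R_g + 2 (n - 1) Δ_g w - (n - 1) (n - 2) |dw|²)`. -/
lemma MetricNear.scalar_conformal (hG : MetricNear G y) (hw : SmoothNear w y)
    (hy : y ∈ halfSpace n) :
    scalar (conformalMetric w G) y = Real.exp (-(2 * w y)) *
      (scalar G y + 2 * ((n : ℝ) - 1) * laplace G w y
        - ((n : ℝ) - 1) * ((n : ℝ) - 2) * ∑ l, pderiv l w y * gradient G w l y) := by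
  have hH : ∀ k l, pderiv k (pderiv l w) y =
      ∑ m, (G y l m * pderiv k (gradient G w m) y
        + pderiv k (fun z => G z l m) y * gradient G w m y) := by
    intro k l
    have hev : pderiv l w =ᶠ[𝓝[halfSpace n] y] fun z => ∑ m, G z l m * gradient G w m z := by
      filter_upwards [hG.eventually, self_mem_nhdsWithin] with z h1 h2
      exact (h1.sum_mul_gradient h2 l).symm
    rw [pderiv_congr hy hev, pderiv_sum _ hy fun m => (hG.smooth l m).mul (hG.smooth_gradient hw m)]
    exact Finset.sum_congr rfl fun m _ => pderiv_mul hy (hG.smooth l m) (hG.smooth_gradient hw m) k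
  have key := trace_ricci_conformalDiff (g := G y) (ginv := fun i j => (G y)⁻¹ i j)
    (θ := fun i => pderiv i w y) (V := fun k => gradient G w k y)
    (Γ := fun k i j => christoffel G k i j y) (dg := fun k i j => pderiv k (fun z => G z i j) y)
    (H := fun k l => pderiv k (pderiv l w) y) (dV := fun k m => pderiv k (gradient G w m) y)
    (hG.inv_symm hy) (hG.symm hy) (hG.sum_inv_mul hy) (fun k => rfl)
    (hG.sum_mul_gradient hy) (hG.christoffel_symm hy) hH (hG.pderiv_metric hy)
  rw [Fintype.card_fin] at key
  have hric : ∑ i, ∑ j, (G y)⁻¹ i j * (ricci (conformalMetric w G) i j y - ricci G i j y) =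
      -2 * ((n : ℝ) - 1) * ∑ i, ∑ j, (G y)⁻¹ i j *
        (pderiv i (pderiv j w) y - ∑ k, christoffel G k i j y * pderiv k w y)
      - ((n : ℝ) - 1) * ((n : ℝ) - 2) * ∑ l, pderiv l w y * gradient G w l y := by
    refine Eq.trans (Finset.sum_congr rfl fun i _ => Finset.sum_congr rfl fun j _ => ?_) key
    congr 1
    simp only [ricci, hG.pderiv_christoffel_conformal hw hy, hG.christoffel_conformal hw hy]
    rw [← Finset.sum_sub_distrib]
    refine Finset.sum_congr rfl fun k _ => ?_
    rw [add_sub_add_comm, ← Finset.sum_sub_distrib]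
    congr 1
    · ring
    · exact Finset.sum_congr rfl fun l _ => by ring
  have hlap : laplace G w y = -∑ i, ∑ j, (G y)⁻¹ i j *
      (pderiv i (pderiv j w) y - ∑ k, christoffel G k i j y * pderiv k w y) := rfl
  have hscal : scalar (conformalMetric w G) y =
      Real.exp (-(2 * w y)) * (scalar G y
        + ∑ i, ∑ j, (G y)⁻¹ i j * (ricci (conformalMetric w G) i j y - ricci G i j y)) := by
    simp only [scalar, hG.inv_conformal hy, mul_sub, Finset.sum_sub_distrib, add_sub_cancel,
      Finset.mul_sum, mul_assoc]
  rw [hscal, hric, hlap]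
  ring

/-- `Δ_{e^{2w} g} f = e^{-2w} (Δ_g f - (n - 2) ⟨dw, df⟩)`. -/
lemma MetricNear.laplace_conformal (hG : MetricNear G y) (hw : SmoothNear w y)
    (hy : y ∈ halfSpace n) (f : EuclideanSpace ℝ (Fin n) → ℝ) :
    laplace (conformalMetric w G) f y = Real.exp (-(2 * w y)) *
      (laplace G f y - ((n : ℝ) - 2) * ∑ k, gradient G w k y * pderiv k f y) := by
  have htr := trace_conformalDiff (g := G y) (ginv := fun i j => (G y)⁻¹ i j)
    (θ := fun i => pderiv i w y) (V := fun k => gradient G w k y)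
    (hG.inv_symm hy) (hG.symm hy) (hG.sum_inv_mul hy) (fun k => rfl)
  rw [Fintype.card_fin] at htr
  set D := conformalDiff (G y) (fun i => pderiv i w y) (fun k => gradient G w k y)
  have h1 : ∑ i, ∑ j, (G y)⁻¹ i j * ∑ k, D k i j * pderiv k f y =
      (2 - (n : ℝ)) * ∑ k, gradient G w k y * pderiv k f y := by
    have : ∑ i, ∑ j, (G y)⁻¹ i j * ∑ k, D k i j * pderiv k f y =
        ∑ k, (∑ i, ∑ j, (G y)⁻¹ i j * D k i j) * pderiv k f y := by
      simp_rw [Finset.mul_sum, Finset.sum_mul]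
      rw [Finset.sum_comm_cycle]
      simp_rw [mul_assoc]
    rw [this, Finset.mul_sum]
    exact Finset.sum_congr rfl fun k _ => by rw [htr]; ring
  have h2 : laplace (conformalMetric w G) f y = Real.exp (-(2 * w y)) *
      (laplace G f y + ∑ i, ∑ j, (G y)⁻¹ i j * ∑ k, D k i j * pderiv k f y) := by
    simp only [laplace, hG.inv_conformal hy, hG.christoffel_conformal hw hy]
    rw [← sub_eq_neg_add, ← Finset.sum_sub_distrib, ← Finset.sum_neg_distrib, Finset.mul_sum]
    refine Finset.sum_congr rfl fun i _ => ?_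
    rw [← Finset.sum_sub_distrib, ← Finset.sum_neg_distrib, Finset.mul_sum]
    refine Finset.sum_congr rfl fun j _ => ?_
    simp only [add_mul, Finset.sum_add_distrib]
    ring
  rw [h2, h1]
  ring

/-- The Laplacian of a product of the form `s e^{-κ w} u`. -/
lemma MetricNear.laplace_const_mul_exp_mul (hG : MetricNear G y) (hw : SmoothNear w y)
    (hu : SmoothNear u y) (hy : y ∈ halfSpace n) (s κ : ℝ) :
    (∀ i, pderiv i (fun z => s * Real.exp (-κ * w z) * u z) y =
      s * Real.exp (-κ * w y) * (pderiv i u y - κ * u y * pderiv i w y)) ∧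
    laplace G (fun z => s * Real.exp (-κ * w z) * u z) y = s * Real.exp (-κ * w y) *
      (laplace G u y + 2 * κ * ∑ k, gradient G w k y * pderiv k u y - κ * u y * laplace G w y
        - κ ^ 2 * u y * ∑ k, pderiv k w y * gradient G w k y) := by
  have hE : ∀ {z : EuclideanSpace ℝ (Fin n)}, SmoothNear w z →
      SmoothNear (fun z => s * Real.exp (-κ * w z)) z := fun h => (h.const_mul _).exp.const_mul s
  have hdE : ∀ {z : EuclideanSpace ℝ (Fin n)}, z ∈ halfSpace n → SmoothNear w z → ∀ i,
      pderiv i (fun z => s * Real.exp (-κ * w z)) z =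
        s * Real.exp (-κ * w z) * (-κ * pderiv i w z) := by
    intro z hz h i
    rw [pderiv_const_mul hz s (h.const_mul _).exp, pderiv_exp hz (h.const_mul _),
      pderiv_const_mul hz _ h]
    ring
  have h1 : ∀ {z : EuclideanSpace ℝ (Fin n)}, z ∈ halfSpace n → SmoothNear w z →
      SmoothNear u z → ∀ i, pderiv i (fun z => s * Real.exp (-κ * w z) * u z) z =
      s * Real.exp (-κ * w z) * (pderiv i u z - κ * u z * pderiv i w z) := by
    intro z hz h h' i
    rw [pderiv_mul hz (hE h) h', hdE hz h]
    ring
  refine ⟨h1 hy hw hu, ?_⟩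
  have h2 : ∀ i j, pderiv i (pderiv j (fun z => s * Real.exp (-κ * w z) * u z)) y =
      s * Real.exp (-κ * w y) * (pderiv i (pderiv j u) y - κ * (pderiv i u y * pderiv j w y)
        - κ * (pderiv j u y * pderiv i w y) - κ * u y * pderiv i (pderiv j w) y
        + κ ^ 2 * u y * (pderiv i w y * pderiv j w y)) := by
    intro i j
    have hev : pderiv j (fun z => s * Real.exp (-κ * w z) * u z) =ᶠ[𝓝[halfSpace n] y]
        fun z => s * Real.exp (-κ * w z) * (pderiv j u z - κ * u z * pderiv j w z) := by
      filter_upwards [hw.eventually, hu.eventually, self_mem_nhdsWithin] with z a1 a2 a3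
      exact h1 a3 a1 a2 j
    rw [pderiv_congr hy hev, pderiv_mul hy (hE hw)
      ((hu.pderiv j).sub ((hu.const_mul κ).mul (hw.pderiv j))),
      pderiv_sub hy (hu.pderiv j) ((hu.const_mul κ).mul (hw.pderiv j)),
      pderiv_mul hy (hu.const_mul κ) (hw.pderiv j), pderiv_const_mul hy κ hu, hdE hy hw]
    ring
  have e1 : ∑ i, ∑ j, (G y)⁻¹ i j * (pderiv i u y * pderiv j w y) =
      ∑ k, gradient G w k y * pderiv k u y := by
    refine Finset.sum_congr rfl fun i _ => ?_
    rw [gradient, Finset.sum_mul]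
    exact Finset.sum_congr rfl fun j _ => by ring
  have e2 : ∑ i, ∑ j, (G y)⁻¹ i j * (pderiv j u y * pderiv i w y) =
      ∑ k, gradient G w k y * pderiv k u y := by
    rw [← e1, Finset.sum_comm]
    exact Finset.sum_congr rfl fun i _ => Finset.sum_congr rfl fun j _ => by
      rw [hG.inv_symm hy]
  have e3 : ∑ i, ∑ j, (G y)⁻¹ i j * (pderiv i w y * pderiv j w y) =
      ∑ k, pderiv k w y * gradient G w k y := by
    refine Finset.sum_congr rfl fun i _ => ?_
    rw [gradient, Finset.mul_sum]
    exact Finset.sum_congr rfl fun j _ => by ring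
  rw [← e3, two_mul, add_mul]
  nth_rewrite 1 [← e1]
  rw [← e2]
  simp only [laplace, h2, h1 hy hw hu, mul_neg, ← Finset.sum_neg_distrib, Finset.mul_sum,
    ← Finset.sum_add_distrib, ← Finset.sum_sub_distrib]
  refine Finset.sum_congr rfl fun i _ => Finset.sum_congr rfl fun j _ => ?_
  have e4 : ∑ k, christoffel G k i j y *
      (s * Real.exp (-κ * w y) * (pderiv k u y - κ * u y * pderiv k w y)) =
      s * Real.exp (-κ * w y) * (∑ k, christoffel G k i j y * pderiv k u y
        - κ * u y * ∑ k, christoffel G k i j y * pderiv k w y) := by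
    simp only [Finset.mul_sum, ← Finset.sum_sub_distrib]
    exact Finset.sum_congr rfl fun k _ => by ring
  rw [e4]
  ring

/-- Conformal covariance of `P₁`: with `f = s e^{-(n-2)w/2} u`, the value of `P_{e^{2w}g} f` is
`s e^{-(n+2)w/2} P_g u`. -/
lemma MetricNear.conformalLaplacian_conformal (hn : 2 ≤ n) (hG : MetricNear G y)
    (hw : SmoothNear w y) (hu : SmoothNear u y) (hy : y ∈ halfSpace n) (s : ℝ) :
    laplace (conformalMetric w G) (fun z => s * Real.exp (-(((n : ℝ) - 2) / 2) * w z) * u z) y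
      + ((n : ℝ) - 2) / (4 * ((n : ℝ) - 1)) * scalar (conformalMetric w G) y
        * (s * Real.exp (-(((n : ℝ) - 2) / 2) * w y) * u y)
    = Real.exp (-(2 * w y)) * (s * Real.exp (-(((n : ℝ) - 2) / 2) * w y)) *
      (laplace G u y + ((n : ℝ) - 2) / (4 * ((n : ℝ) - 1)) * scalar G y * u y) := by
  obtain ⟨h1, h2⟩ := hG.laplace_const_mul_exp_mul hw hu hy s (((n : ℝ) - 2) / 2)
  have hn1 : (n : ℝ) - 1 ≠ 0 := by
    have : (2 : ℝ) ≤ n := by exact_mod_cast hn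
    linarith
  have h3 : ∑ k, gradient G w k y *
        (s * Real.exp (-(((n : ℝ) - 2) / 2) * w y) *
          (pderiv k u y - ((n : ℝ) - 2) / 2 * u y * pderiv k w y))
      = s * Real.exp (-(((n : ℝ) - 2) / 2) * w y) * (∑ k, gradient G w k y * pderiv k u y
        - ((n : ℝ) - 2) / 2 * u y * ∑ k, pderiv k w y * gradient G w k y) := by
    simp only [Finset.mul_sum, ← Finset.sum_sub_distrib]
    exact Finset.sum_congr rfl fun k _ => by ring
  rw [hG.laplace_conformal hw hy, h2, hG.scalar_conformal hw hy]
  simp only [h1, h3]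
  field_simp
  ring

/-! ### Conformal change of the boundary geometry -/

lemma MetricNear.normal_conformal (hG : MetricNear G y) (hy : y ∈ halfSpace n) (i : Fin n) :
    normal (conformalMetric w G) y i = Real.exp (-w y) * normal G y i := by
  have h1 : Real.exp (-(2 * w y)) = Real.exp (-w y) ^ 2 := by
    rw [← Real.exp_nat_mul]; congr 1; push_cast; ring
  have h2 : √(Real.exp (-w y) ^ 2 * (G y)⁻¹ 0 0) = Real.exp (-w y) * √((G y)⁻¹ 0 0) := by
    rw [Real.sqrt_mul (by positivity), Real.sqrt_sq (Real.exp_pos _).le]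
  have h3 : 0 < √((G y)⁻¹ 0 0) := Real.sqrt_pos.2 (hG.posDef_self hy).inv.diag_pos
  simp only [normal, hG.inv_conformal hy, h1, h2]
  have := Real.exp_pos (-w y)
  field_simp

lemma MetricNear.normalDeriv_conformal (hG : MetricNear G y) (hy : y ∈ halfSpace n)
    (f : EuclideanSpace ℝ (Fin n) → ℝ) :
    normalDeriv (conformalMetric w G) f y = Real.exp (-w y) * normalDeriv G f y := by
  simp only [normalDeriv, hG.normal_conformal hy, Finset.mul_sum, mul_assoc]

/-- The unit normal is orthogonal to the boundary. -/
lemma MetricNear.sum_metric_mul_normal (hG : MetricNear G y) (hy : y ∈ halfSpace n) {a : Fin n}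
    (ha : a ≠ 0) : ∑ k, G y k a * normal G y k = 0 := by
  have : ∀ k, G y k a * normal G y k = -(G y a k * (G y)⁻¹ k 0) / √((G y)⁻¹ 0 0) := fun k => by
    rw [normal, hG.symm hy k a]
    ring
  simp_rw [this]
  rw [← Finset.sum_div, Finset.sum_neg_distrib, hG.sum_mul_inv hy, if_neg ha]
  simp

lemma MetricNear.inducedMetric_posDef (hG : MetricNear G y) (hy : y ∈ halfSpace n) :
    (inducedMetric G y).PosDef :=
  (hG.posDef_self hy).submatrix Subtype.val_injective

/-- `II_{e^{2w} g} = e^{w} (II_g + (∂_ν w) g)`. -/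
lemma MetricNear.secondFundForm_conformal (hG : MetricNear G y) (hw : SmoothNear w y)
    (hy : y ∈ halfSpace n) (a b : {i : Fin n // i ≠ 0}) :
    secondFundForm (conformalMetric w G) y a b =
      Real.exp (w y) * (secondFundForm G y a b + normalDeriv G w y * inducedMetric G y a b) := by
  have he : Real.exp (2 * w y) * Real.exp (-w y) = Real.exp (w y) := by
    rw [← Real.exp_add]; congr 1; ring
  set X := conformalDiff (G y) (fun i => pderiv i w y) (fun k => gradient G w k y) with hX
  have h1 : ∑ k, ∑ l, G y k l * normal G y k * X l a b =
      -(normalDeriv G w y * inducedMetric G y a b) := by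
    have e1 : ∀ k, ∑ l, G y k l * normal G y k * X l a b =
        G y k a * normal G y k * pderiv (b : Fin n) w y
          + G y k b * normal G y k * pderiv (a : Fin n) w y
          - G y a b * (normal G y k * pderiv k w y) := by
      intro k
      rw [← hG.sum_mul_gradient hy k]
      simp only [hX, conformalDiff, mul_sub, mul_add, Finset.sum_sub_distrib,
        Finset.sum_add_distrib, mul_ite, mul_zero, Finset.sum_ite_eq', Finset.mem_univ, if_true,
        Finset.mul_sum]
      congr 1
      exact Finset.sum_congr rfl fun l _ => by ring
    simp_rw [e1, Finset.sum_sub_distrib, Finset.sum_add_distrib, ← Finset.sum_mul,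
      ← Finset.mul_sum]
    rw [hG.sum_metric_mul_normal hy a.2, hG.sum_metric_mul_normal hy b.2]
    simp only [normalDeriv, inducedMetric, Matrix.of_apply]
    ring
  have h2 : secondFundForm (conformalMetric w G) y a b = Real.exp (w y) *
      (secondFundForm G y a b - ∑ k, ∑ l, G y k l * normal G y k * X l a b) := by
    simp only [secondFundForm, hG.normal_conformal hy, hG.christoffel_conformal hw hy]
    rw [← neg_add', ← Finset.sum_add_distrib, mul_neg, Finset.mul_sum]
    congr 1
    refine Finset.sum_congr rfl fun k _ => ?_
    rw [← Finset.sum_add_distrib, Finset.mul_sum]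
    refine Finset.sum_congr rfl fun l _ => ?_
    have : conformalMetric w G y k l = Real.exp (2 * w y) * G y k l := rfl
    rw [this, ← he]
    ring
  rw [h2, h1]
  ring

/-- `h_{e^{2w} g} = e^{-w} (h_g + (n - 1) ∂_ν w)`. -/
lemma MetricNear.mean_conformal (hG : MetricNear G y) (hw : SmoothNear w y)
    (hy : y ∈ halfSpace n) :
    mean (conformalMetric w G) y =
      Real.exp (-w y) * (mean G y + ((n : ℝ) - 1) * normalDeriv G w y) := by
  have hpd := hG.inducedMetric_posDef hy
  have hdet : IsUnit (inducedMetric G y).det := hpd.det_pos.ne'.isUnit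
  have h1 : inducedMetric (conformalMetric w G) y = Real.exp (2 * w y) • inducedMetric G y := rfl
  have h2 : ∑ a, ∑ b, (inducedMetric G y)⁻¹ a b * inducedMetric G y a b = (n : ℝ) - 1 := by
    have e : ∀ a, ∑ b, (inducedMetric G y)⁻¹ a b * inducedMetric G y a b = 1 := by
      intro a
      have := congrFun (congrFun (Matrix.nonsing_inv_mul _ hdet) a) a
      rw [Matrix.mul_apply, Matrix.one_apply_eq] at this
      rw [← this]
      exact Finset.sum_congr rfl fun b _ => by
        rw [show inducedMetric G y a b = inducedMetric G y b a from hG.symm hy _ _]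
    simp_rw [e]
    rw [Finset.sum_const, Finset.card_univ, nsmul_one, Fintype.card_subtype_compl]
    simp [Nat.cast_sub (NeZero.one_le : 1 ≤ n)]
  have he : Real.exp (-(2 * w y)) * Real.exp (w y) = Real.exp (-w y) := by
    rw [← Real.exp_add]; congr 1; ring
  rw [mean, h1, inv_exp_smul _ hdet, mean, ← h2, ← he]
  simp only [hG.secondFundForm_conformal hw hy, Matrix.smul_apply, smul_eq_mul, Finset.mul_sum,
    Finset.sum_mul, ← Finset.sum_add_distrib]
  exact Finset.sum_congr rfl fun a _ => Finset.sum_congr rfl fun b _ => by ring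

/-- Conformal covariance of the Robin operator: with `f = s e^{-(n-2)w/2} u`, the value of
`B_{e^{2w}g} f` is `s e^{-nw/2} B_g u`. -/
lemma MetricNear.robinOperator_conformal (hn : 2 ≤ n) (hG : MetricNear G y)
    (hw : SmoothNear w y) (hu : SmoothNear u y) (hy : y ∈ halfSpace n) (s : ℝ) :
    normalDeriv (conformalMetric w G) (fun z => s * Real.exp (-(((n : ℝ) - 2) / 2) * w z) * u z) y
      + ((n : ℝ) - 2) / (2 * ((n : ℝ) - 1)) * mean (conformalMetric w G) y
        * (s * Real.exp (-(((n : ℝ) - 2) / 2) * w y) * u y)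
    = Real.exp (-w y) * (s * Real.exp (-(((n : ℝ) - 2) / 2) * w y)) *
      (normalDeriv G u y + ((n : ℝ) - 2) / (2 * ((n : ℝ) - 1)) * mean G y * u y) := by
  obtain ⟨h1, -⟩ := hG.laplace_const_mul_exp_mul hw hu hy s (((n : ℝ) - 2) / 2)
  have hn1 : (n : ℝ) - 1 ≠ 0 := by
    have : (2 : ℝ) ≤ n := by exact_mod_cast hn
    linarith
  have h3 : normalDeriv G (fun z => s * Real.exp (-(((n : ℝ) - 2) / 2) * w z) * u z) y
      = s * Real.exp (-(((n : ℝ) - 2) / 2) * w y) * (normalDeriv G u y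
        - ((n : ℝ) - 2) / 2 * u y * normalDeriv G w y) := by
    simp only [normalDeriv, h1, Finset.mul_sum, ← Finset.sum_sub_distrib]
    exact Finset.sum_congr rfl fun k _ => by ring
  rw [hG.normalDeriv_conformal hy, h3, hG.mean_conformal hw hy]
  field_simp
  ring

end ConformalChange

/-! ### First and second order conditions at a minimum -/

section Minimum

variable {n : ℕ} [NeZero n] {G : EuclideanSpace ℝ (Fin n) → Matrix (Fin n) (Fin n) ℝ}
  {f : EuclideanSpace ℝ (Fin n) → ℝ} {y : EuclideanSpace ℝ (Fin n)}

/-- The second derivative at a local minimum is nonnegative. -/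
lemma nonneg_of_isLocalMin {φ φ' : ℝ → ℝ} {a t : ℝ} (hmin : IsLocalMin φ t)
    (hφ : ∀ᶠ s in 𝓝 t, HasDerivAt φ (φ' s) s) (hφ' : HasDerivAt φ' a t) : 0 ≤ a := by
  by_contra! ha
  have hd : deriv φ =ᶠ[𝓝 t] φ' := hφ.mono fun s hs => hs.deriv
  have h2 : deriv (deriv φ) t = a := by rw [hd.deriv_eq, hφ'.deriv]
  have h1 : deriv φ t = 0 := hmin.deriv_eq_zero
  have hmax := isLocalMax_of_deriv_deriv_neg (by rwa [h2]) h1 hφ.self_of_nhds.continuousAt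
  -- a minimum that is also a maximum: `φ` is locally constant
  have hc : φ =ᶠ[𝓝 t] fun _ => φ t := by
    filter_upwards [hmin, hmax] with s h3 h4 using le_antisymm h4 h3
  have h5 : deriv (deriv φ) t = 0 := by
    rw [hc.deriv.deriv_eq]
    simp
  linarith

lemma eventually_pos (hy : 0 < y 0) : ∀ᶠ z : EuclideanSpace ℝ (Fin n) in 𝓝 y, 0 < z 0 :=
  (isOpen_lt continuous_const (by fun_prop)).mem_nhds hy

lemma halfSpace_mem_nhds (hy : 0 < y 0) : halfSpace n ∈ 𝓝 y :=
  (eventually_pos hy).mono fun _ hz => hz.le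

lemma SmoothNear.hasFDerivAt (hf : SmoothNear f y) (hy : 0 < y 0) :
    HasFDerivAt f (fderivWithin ℝ f (halfSpace n) y) y :=
  (hf.differentiableWithinAt hy.le).hasFDerivWithinAt.hasFDerivAt (halfSpace_mem_nhds hy)

lemma fderivWithin_apply_eq_sum (v : EuclideanSpace ℝ (Fin n)) :
    fderivWithin ℝ f (halfSpace n) y v = ∑ i, v i * pderiv i f y := by
  have hv : v = ∑ i, v i • (coordVec i : EuclideanSpace ℝ (Fin n)) := by
    ext j
    simp [coordVec, Pi.single_apply]
  conv_lhs => rw [hv]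
  simp [pderiv]

/-- The second-order condition at an interior minimum, in the direction `v`. -/
lemma sum_mul_pderiv_pderiv_nonneg (hf : SmoothNear f y) (hy : 0 < y 0) (hmin : IsLocalMin f y)
    (v : EuclideanSpace ℝ (Fin n)) :
    0 ≤ ∑ i, ∑ j, v i * v j * pderiv i (pderiv j f) y := by
  have hline : ∀ t : ℝ, HasDerivAt (fun t : ℝ => y + t • v) v t := fun t => by
    simpa using ((hasDerivAt_id t).smul_const v).const_add y
  have h0 : y + (0 : ℝ) • v = y := by simp
  have hcont : Filter.Tendsto (fun t : ℝ => y + t • v) (𝓝 0) (𝓝 y) := by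
    have := (hline 0).continuousAt.tendsto
    rwa [h0] at this
  have hsm : ∀ᶠ z in 𝓝 y, SmoothNear f z := by
    have := hf.eventually
    rwa [nhdsWithin_eq_nhds.2 (halfSpace_mem_nhds hy)] at this
  have hmin' : IsLocalMin (fun t : ℝ => f (y + t • v)) 0 := by
    have := hcont.eventually hmin
    simpa only [IsLocalMin, IsMinFilter, h0] using this
  refine nonneg_of_isLocalMin (φ' := fun t => ∑ j, v j * pderiv j f (y + t • v)) hmin' ?_ ?_
  · filter_upwards [hcont.eventually (eventually_pos hy), hcont.eventually hsm] with t h1 h2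
    have := (h2.hasFDerivAt h1).comp_hasDerivAt t (hline t)
    rwa [fderivWithin_apply_eq_sum] at this
  · rw [Finset.sum_comm]
    refine HasDerivAt.fun_sum fun j _ => ?_
    have h1 : HasFDerivAt (pderiv j f) (fderivWithin ℝ (pderiv j f) (halfSpace n) y)
        (y + (0 : ℝ) • v) := by
      rw [h0]
      exact (hf.pderiv j).hasFDerivAt hy
    have h2 := (h1.comp_hasDerivAt (0 : ℝ) (hline 0)).const_mul (v j)
    rw [fderivWithin_apply_eq_sum, Finset.mul_sum] at h2
    exact h2.congr_deriv (Finset.sum_congr rfl fun i _ => by ring)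

open scoped MatrixOrder Matrix.Norms.L2Operator in
/-- A positive semidefinite matrix is of the form `Bᵀ B`. -/
lemma exists_eq_sum_of_posSemidef {ι : Type*} [Fintype ι] [DecidableEq ι] {A : Matrix ι ι ℝ}
    (hA : A.PosSemidef) : ∃ B : Matrix ι ι ℝ, ∀ i j, A i j = ∑ k, B k i * B k j := by
  obtain ⟨B, rfl⟩ := CStarAlgebra.nonneg_iff_eq_star_mul_self.mp hA.nonneg
  exact ⟨B, fun i j => by simp [Matrix.mul_apply, Matrix.star_eq_conjTranspose]⟩

/-- The positive Laplacian is nonpositive at an interior local minimum. -/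
lemma MetricNear.laplace_nonpos (hG : MetricNear G y) (hf : SmoothNear f y) (hy : 0 < y 0)
    (hmin : IsLocalMin f y) : laplace G f y ≤ 0 := by
  have h1 : ∀ k, pderiv k f y = 0 := fun k => by
    rw [pderiv, fderivWithin_of_mem_nhds (halfSpace_mem_nhds hy), hmin.fderiv_eq_zero]
    rfl
  obtain ⟨B, hB⟩ := exists_eq_sum_of_posSemidef (hG.posDef_self hy.le).inv.posSemidef
  have h2 : laplace G f y = -∑ k, ∑ i, ∑ j, B k i * B k j * pderiv i (pderiv j f) y := by
    simp only [laplace, h1, mul_zero, Finset.sum_const_zero, sub_zero, hB, Finset.sum_mul]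
    rw [Finset.sum_comm_cycle]
  rw [h2, Left.neg_nonpos_iff]
  exact Finset.sum_nonneg fun k _ => sum_mul_pderiv_pderiv_nonneg hf hy hmin (WithLp.toLp 2 (B k))

/-- The first derivatives at a local minimum on the boundary. -/
lemma pderiv_of_isLocalMinOn (hf : SmoothNear f y) (hy : y 0 = 0)
    (hmin : IsLocalMinOn f (halfSpace n) y) :
    0 ≤ pderiv 0 f y ∧ ∀ a ≠ 0, pderiv a f y = 0 := by
  have hyH : y ∈ halfSpace n := hy.ge
  have hd := (hf.differentiableWithinAt hyH).hasFDerivWithinAt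
  have hconv : Convex ℝ (halfSpace n) := EuclideanHalfSpace.convex (n := n)
  have hcone : ∀ v : EuclideanSpace ℝ (Fin n), 0 ≤ v 0 →
      v ∈ posTangentConeAt (halfSpace n) y := fun v hv => by
    refine mem_posTangentConeAt_of_segment_subset (hconv.segment_subset hyH ?_)
    simpa [halfSpace, hy] using hv
  refine ⟨hmin.hasFDerivWithinAt_nonneg hd (hcone _ (by simp [coordVec])), fun a ha => ?_⟩
  exact hmin.hasFDerivWithinAt_eq_zero hd (hcone _ (by simp [coordVec, ha.symm]))
    (hcone _ (by simp [coordVec, ha.symm]))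

lemma MetricNear.normalDeriv_of_isLocalMinOn (hG : MetricNear G y) (hf : SmoothNear f y)
    (hy : y 0 = 0) (hmin : IsLocalMinOn f (halfSpace n) y) :
    normalDeriv G f y = -(√((G y)⁻¹ 0 0) * pderiv 0 f y) ∧ 0 < √((G y)⁻¹ 0 0) := by
  have h3 : 0 < (G y)⁻¹ 0 0 := (hG.posDef_self hy.ge).inv.diag_pos
  refine ⟨?_, Real.sqrt_pos.2 h3⟩
  rw [normalDeriv, Finset.sum_eq_single 0]
  · rw [normal, neg_div, Real.div_sqrt, neg_mul]
  · intro a _ ha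
    rw [(pderiv_of_isLocalMinOn hf hy hmin).2 a ha, mul_zero]
  · simp

/-- The outward normal derivative is nonpositive at a local minimum on the boundary. -/
lemma MetricNear.normalDeriv_nonpos (hG : MetricNear G y) (hf : SmoothNear f y)
    (hy : y 0 = 0) (hmin : IsLocalMinOn f (halfSpace n) y) : normalDeriv G f y ≤ 0 := by
  obtain ⟨h1, h2⟩ := hG.normalDeriv_of_isLocalMinOn hf hy hmin
  have := (pderiv_of_isLocalMinOn hf hy hmin).1
  rw [h1, Left.neg_nonpos_iff]
  positivity

/-- A local minimum on the boundary at which the normal derivative vanishes is a critical point. -/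
lemma MetricNear.fderivWithin_eq_zero_of_normalDeriv_eq_zero (hG : MetricNear G y)
    (hf : SmoothNear f y) (hy : y 0 = 0) (hmin : IsLocalMinOn f (halfSpace n) y)
    (hν : normalDeriv G f y = 0) (v : EuclideanSpace ℝ (Fin n)) :
    fderivWithin ℝ f (halfSpace n) y v = 0 := by
  obtain ⟨h1, h2⟩ := hG.normalDeriv_of_isLocalMinOn hf hy hmin
  have h0 : pderiv 0 f y = 0 := by
    rw [hν] at h1
    simpa [h2.ne'] using h1.symm
  rw [fderivWithin_apply_eq_sum]
  refine Finset.sum_eq_zero fun i _ => ?_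
  by_cases hi : i = 0
  · rw [hi, h0, mul_zero]
  · rw [(pderiv_of_isLocalMinOn hf hy hmin).2 i hi, mul_zero]

end Minimum

/-! ### Invariance of the Laplacian under changes of coordinates -/

section ChangeOfCoordinates

section Algebra

variable {ι : Type*} [Fintype ι] [DecidableEq ι]

/-- The transformation law of the Christoffel symbols: `Γ` and `Γ'` are the Christoffel symbols in
the two coordinate systems, `J` and `K` the first and second derivatives of the change of
coordinates, `g` the metric and `dg` its derivatives, and `hlow'` expresses that the first
derivatives of the transformed metric are given by the product rule. -/
lemma christoffel_transformation {g g' J : Matrix ι ι ℝ} {dg Γ Γ' K : ι → ι → ι → ℝ}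
    (hg : ∀ a b, g a b = g b a) (hg' : g' = J * g * J.transpose) (hdet : IsUnit g'.det)
    (hK : ∀ i j a, K i j a = K j i a)
    (hlow : ∀ c p q, ∑ a, g c a * Γ a p q = (1 / 2) * (dg p q c + dg q p c - dg c p q))
    {dg' : ι → ι → ι → ℝ}
    (hlow' : ∀ m i j, ∑ k, g' m k * Γ' k i j = (1 / 2) * (dg' i j m + dg' j i m - dg' m i j))
    (hdg' : ∀ k i j, dg' k i j = ∑ a, ∑ b, (K k i a * J j b * g a b + J i a * K k j b * g a b
      + J i a * J j b * ∑ c, J k c * dg c a b)) (i j d : ι) :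
    ∑ k, J k d * Γ' k i j = ∑ p, ∑ q, J i p * J j q * Γ d p q + K i j d := by
  set B : (ι → ℝ) → (ι → ℝ) → ℝ := fun x y => ∑ a, ∑ b, x a * y b * g a b with hB
  set C : (ι → ℝ) → (ι → ℝ) → (ι → ℝ) → ℝ :=
    fun x y z => ∑ a, ∑ b, y a * z b * ∑ c, x c * dg c a b with hC
  have hBs : ∀ x y, B x y = B y x := fun x y => by
    simp only [hB]
    rw [Finset.sum_comm]
    exact Finset.sum_congr rfl fun a _ => Finset.sum_congr rfl fun b _ => by rw [hg]; ring
  have hdg2 : ∀ k i j, dg' k i j = B (K k i) (J j) + B (J i) (K k j) + C (J k) (J i) (J j) := by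
    intro k i j
    simp only [hdg', hB, hC, Finset.sum_add_distrib]
  -- both sides agree after multiplication with the invertible matrix `J g`
  have hunit : IsUnit (J * g) := by
    rw [hg', Matrix.det_mul] at hdet
    exact (Matrix.isUnit_iff_isUnit_det _).2 (isUnit_of_mul_isUnit_left hdet)
  have hKs : ∀ i j, K i j = K j i := fun i j => funext (hK i j)
  have hCC : ∀ m, C (J i) (J j) (J m) + C (J j) (J i) (J m) - C (J m) (J i) (J j)
      = 2 * ∑ c, J m c * ∑ a, g c a * ∑ p, ∑ q, J i p * J j q * Γ a p q := by
    intro m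
    have e1 : ∀ c, ∑ a, g c a * ∑ p, ∑ q, J i p * J j q * Γ a p q =
        ∑ p, ∑ q, J i p * J j q * ((1 / 2) * (dg p q c + dg q p c - dg c p q)) := by
      intro c
      simp_rw [← hlow, Finset.mul_sum]
      conv_rhs => rw [Finset.sum_comm_cycle]
      exact Finset.sum_congr rfl fun a _ => Finset.sum_congr rfl fun b _ =>
        Finset.sum_congr rfl fun c _ => by ring
    have c1 : C (J i) (J j) (J m) =
        ∑ c, ∑ p, ∑ q, J j q * J m c * (J i p * dg p q c) := by
      simp only [hC, Finset.mul_sum]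
      conv_lhs => rw [Finset.sum_comm_cycle, Finset.sum_comm_cycle]
    have c2 : C (J j) (J i) (J m) =
        ∑ c, ∑ p, ∑ q, J i p * J m c * (J j q * dg q p c) := by
      simp only [hC, Finset.mul_sum]
      rw [Finset.sum_comm]
    have c3 : C (J m) (J i) (J j) =
        ∑ c, ∑ p, ∑ q, J i p * J j q * (J m c * dg c p q) := by
      simp only [hC, Finset.mul_sum]
      conv_lhs => rw [Finset.sum_comm_cycle]
    simp only [e1]
    simp only [c1, c2, c3, Finset.mul_sum, ← Finset.sum_add_distrib,
      ← Finset.sum_sub_distrib]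
    exact Finset.sum_congr rfl fun a _ => Finset.sum_congr rfl fun b _ =>
      Finset.sum_congr rfl fun c _ => by ring
  have hfun : (fun d => ∑ k, J k d * Γ' k i j) =
      fun d => ∑ p, ∑ q, J i p * J j q * Γ d p q + K i j d := by
    apply Matrix.mulVec_injective_of_isUnit hunit
    funext m
    have hl : (J * g).mulVec (fun d => ∑ k, J k d * Γ' k i j) m = ∑ k, g' m k * Γ' k i j := by
      have : (fun d => ∑ k, J k d * Γ' k i j) = J.transpose.mulVec fun k => Γ' k i j := rfl
      rw [this, Matrix.mulVec_mulVec, ← hg']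
      rfl
    have hr : (J * g).mulVec (fun d => ∑ p, ∑ q, J i p * J j q * Γ d p q + K i j d) m =
        ∑ c, J m c * ∑ a, g c a * ∑ p, ∑ q, J i p * J j q * Γ a p q + B (J m) (K i j) := by
      rw [← Matrix.mulVec_mulVec]
      simp only [Matrix.mulVec, dotProduct, mul_add, Finset.sum_add_distrib, hB, Finset.mul_sum]
      congr 1
      exact Finset.sum_congr rfl fun a _ => Finset.sum_congr rfl fun b _ => by ring
    rw [hl, hr, hlow', hdg2, hdg2, hdg2]
    rw [hBs (J m) (K i j), hBs (J j) (K i m), hBs (J i) (K j m), hBs (J i) (K m j), hKs j i,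
      hKs m i, hKs m j]
    linear_combination (1 / 2) * hCC m
  exact congrFun hfun d

end Algebra

variable {n : ℕ} [NeZero n] {T : EuclideanSpace ℝ (Fin n) → EuclideanSpace ℝ (Fin n)}
  {z : EuclideanSpace ℝ (Fin n)}

lemma pderiv_eq_fderiv {f : EuclideanSpace ℝ (Fin n) → ℝ} (hz : 0 < z 0) (i : Fin n) :
    pderiv i f z = fderiv ℝ f z (coordVec i) := by
  rw [pderiv, fderivWithin_of_mem_nhds (halfSpace_mem_nhds hz)]

lemma smoothNear_iff_of_pos {f : EuclideanSpace ℝ (Fin n) → ℝ} (hz : 0 < z 0) :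
    SmoothNear f z ↔ ∀ᶠ x in 𝓝 z, ContDiffAt ℝ ∞ f x := by
  rw [SmoothNear, nhdsWithin_eq_nhds.2 (halfSpace_mem_nhds hz)]
  refine Filter.eventually_congr ((eventually_pos hz).mono fun x hx => ?_)
  exact contDiffWithinAt_iff_contDiffAt (halfSpace_mem_nhds hx)

lemma SmoothNear.comp {f : EuclideanSpace ℝ (Fin n) → ℝ} (hf : SmoothNear f (T z))
    (hT : ∀ᶠ x in 𝓝 z, ContDiffAt ℝ ∞ T x) (hz : 0 < z 0) (hTz : 0 < T z 0) :
    SmoothNear (fun x => f (T x)) z := by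
  rw [smoothNear_iff_of_pos hTz] at hf
  rw [smoothNear_iff_of_pos hz]
  filter_upwards [hT.self_of_nhds.continuousAt.eventually hf, hT] with x h1 h2
  exact ContDiffAt.comp x h1 h2

lemma smoothNear_coord (hT : ∀ᶠ x in 𝓝 z, ContDiffAt ℝ ∞ T x) (hz : 0 < z 0) (a : Fin n) :
    SmoothNear (fun x => T x a) z := by
  rw [smoothNear_iff_of_pos hz]
  filter_upwards [hT] with x hx
  exact (contDiffAt_euclidean.1 hx) a

lemma pderiv_comp {f : EuclideanSpace ℝ (Fin n) → ℝ} (hf : SmoothNear f (T z))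
    (hT : ContDiffAt ℝ ∞ T z) (hz : 0 < z 0) (hTz : 0 < T z 0) (i : Fin n) :
    pderiv i (fun x => f (T x)) z = ∑ a, pderiv i (fun x => T x a) z * pderiv a f (T z) := by
  have h1 := hf.hasFDerivAt hTz
  have hTd : HasFDerivAt T (fderiv ℝ T z) z := (hT.differentiableAt (by simp)).hasFDerivAt
  have h2 : pderiv i (fun x => f (T x)) z =
      fderivWithin ℝ f (halfSpace n) (T z) (fderiv ℝ T z (coordVec i)) := by
    rw [pderiv_eq_fderiv hz, show fderiv ℝ (fun x => f (T x)) z = _ from (h1.comp z hTd).fderiv]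
    rfl
  rw [h2, fderivWithin_apply_eq_sum]
  refine Finset.sum_congr rfl fun a _ => ?_
  rw [pderiv_eq_fderiv hz, show fderiv ℝ (fun x => T x a) z = _ from
    ((EuclideanSpace.proj a : EuclideanSpace ℝ (Fin n) →L[ℝ] ℝ).hasFDerivAt.comp z hTd).fderiv]
  rfl

lemma pderiv_comm {f : EuclideanSpace ℝ (Fin n) → ℝ} (hf : SmoothNear f z) (hz : 0 < z 0)
    (i j : Fin n) : pderiv i (pderiv j f) z = pderiv j (pderiv i f) z := by
  have hsm := ((smoothNear_iff_of_pos hz).1 hf).self_of_nhds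
  have h1 : ∀ i j, pderiv i (pderiv j f) z =
      fderiv ℝ (fderiv ℝ f) z (coordVec i) (coordVec j) := by
    intro i j
    have hev : pderiv j f =ᶠ[𝓝 z] fun x => fderiv ℝ f x (coordVec j) :=
      (eventually_pos hz).mono fun x hx => pderiv_eq_fderiv hx j
    rw [pderiv_eq_fderiv hz, hev.fderiv_eq, fderiv_clm_apply
      ((hsm.fderiv_right (m := 1) (by norm_cast)).differentiableAt one_ne_zero)
      (differentiableAt_const _)]
    simp
  rw [h1, h1]
  exact (hsm.isSymmSndFDerivAt (by simpa using ENat.LEInfty.out)) _ _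

/-- The Laplacian does not depend on the coordinates: if `G'` is the pull-back of the metric `G`
under the change of coordinates `T`, then `Δ_{G'} (f ∘ T) = (Δ_G f) ∘ T` at interior points. -/
lemma laplace_comp {G G' : EuclideanSpace ℝ (Fin n) → Matrix (Fin n) (Fin n) ℝ}
    {f : EuclideanSpace ℝ (Fin n) → ℝ} (hG : MetricNear G (T z)) (hG' : MetricNear G' z)
    (hf : SmoothNear f (T z)) (hT : ∀ᶠ x in 𝓝 z, ContDiffAt ℝ ∞ T x)
    (hz : 0 < z 0) (hTz : 0 < T z 0)
    (hpull : ∀ᶠ x in 𝓝 z, ∀ i j, G' x i j =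
      ∑ a, ∑ b, pderiv i (fun x => T x a) x * pderiv j (fun x => T x b) x * G (T x) a b) :
    laplace G' (fun x => f (T x)) z = laplace G f (T z) := by
  have hzH : z ∈ halfSpace n := hz.le
  have hTzH : T z ∈ halfSpace n := hTz.le
  have hw := nhdsWithin_eq_nhds.2 (halfSpace_mem_nhds hz)
  have hc : ContinuousAt T z := hT.self_of_nhds.continuousAt
  have hpos' : ∀ᶠ x in 𝓝 z, 0 < T x 0 := hc.eventually (eventually_pos hTz)
  have hfe : ∀ᶠ x in 𝓝 z, SmoothNear f (T x) := by
    have := hf.eventually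
    rw [nhdsWithin_eq_nhds.2 (halfSpace_mem_nhds hTz)] at this
    exact hc.eventually this
  set J : Matrix (Fin n) (Fin n) ℝ := Matrix.of fun i a => pderiv i (fun x => T x a) z with hJ
  set K : Fin n → Fin n → Fin n → ℝ := fun i j a => pderiv i (pderiv j fun x => T x a) z with hKdef
  have hTa := smoothNear_coord hT hz
  have hJs : ∀ i a, SmoothNear (pderiv i fun x => T x a) z := fun i a => (hTa a).pderiv i
  have hGT : ∀ a b, SmoothNear (fun x => G (T x) a b) z := fun a b =>
    (hG.smooth a b).comp hT hz hTz
  have hdG' : ∀ k i j, pderiv k (fun x => G' x i j) z = ∑ a, ∑ b,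
      (K k i a * J j b * G (T z) a b + J i a * K k j b * G (T z) a b
        + J i a * J j b * ∑ c, J k c * pderiv c (fun y => G y a b) (T z)) := by
    intro k i j
    have hev : (fun x => G' x i j) =ᶠ[𝓝[halfSpace n] z] fun x =>
        ∑ a, ∑ b, pderiv i (fun x => T x a) x * pderiv j (fun x => T x b) x * G (T x) a b := by
      rw [hw]
      exact hpull.mono fun x hx => hx i j
    rw [pderiv_congr hzH hev, pderiv_sum _ hzH fun a => SmoothNear.sum _ fun b =>
      ((hJs i a).mul (hJs j b)).mul (hGT a b)]
    refine Finset.sum_congr rfl fun a _ => ?_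
    rw [pderiv_sum _ hzH fun b => ((hJs i a).mul (hJs j b)).mul (hGT a b)]
    refine Finset.sum_congr rfl fun b _ => ?_
    rw [pderiv_mul hzH ((hJs i a).mul (hJs j b)) (hGT a b), pderiv_mul hzH (hJs i a) (hJs j b),
      pderiv_comp (hG.smooth a b) hT.self_of_nhds hz hTz]
    simp only [hJ, hKdef, Matrix.of_apply]
    ring
  have hg' : G' z = J * G (T z) * J.transpose := by
    ext i j
    rw [hpull.self_of_nhds i j, Matrix.mul_assoc, Matrix.mul_apply]
    refine Finset.sum_congr rfl fun a _ => ?_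
    rw [Matrix.mul_apply, Finset.mul_sum]
    refine Finset.sum_congr rfl fun b _ => ?_
    simp only [hJ, Matrix.of_apply, Matrix.transpose_apply]
    ring
  have hΓ := christoffel_transformation (g := G (T z)) (g' := G' z) (J := J) (K := K)
    (dg := fun p a b => pderiv p (fun y => G y a b) (T z))
    (dg' := fun p a b => pderiv p (fun y => G' y a b) z)
    (Γ := fun k i j => christoffel G k i j (T z)) (Γ' := fun k i j => christoffel G' k i j z)
    (hG.symm hTzH) hg' (hG'.isUnit_det hzH)
    (fun i j a => pderiv_comm (hTa a) hz i j) (hG.sum_metric_mul_christoffel hTzH)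
    (hG'.sum_metric_mul_christoffel hzH) hdG'
  have hinv : ∀ a b, ∑ i, ∑ j, (G' z)⁻¹ i j * (J i a * J j b) = (G (T z))⁻¹ a b := by
    have hu := hG'.isUnit_det hzH
    have hJu : IsUnit J.det := by
      rw [hg', Matrix.det_mul, Matrix.det_mul] at hu
      exact isUnit_of_mul_isUnit_left (isUnit_of_mul_isUnit_left hu)
    have : J.transpose * (G' z)⁻¹ * J = (G (T z))⁻¹ := by
      rw [hg', Matrix.mul_inv_rev, Matrix.mul_inv_rev, ← Matrix.mul_assoc,
        Matrix.mul_nonsing_inv _ (by rwa [Matrix.det_transpose]), Matrix.one_mul, Matrix.mul_assoc,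
        Matrix.nonsing_inv_mul _ hJu, Matrix.mul_one]
    intro a b
    rw [← this, Matrix.mul_assoc, Matrix.mul_apply]
    refine Finset.sum_congr rfl fun i _ => ?_
    rw [Matrix.mul_apply, Finset.mul_sum]
    exact Finset.sum_congr rfl fun j _ => by rw [Matrix.transpose_apply]; ring
  have hd1 : ∀ i, pderiv i (fun x => f (T x)) z = ∑ a, J i a * pderiv a f (T z) := fun i =>
    pderiv_comp hf hT.self_of_nhds hz hTz i
  have hd2 : ∀ i j, pderiv i (pderiv j fun x => f (T x)) z =
      ∑ a, K i j a * pderiv a f (T z)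
        + ∑ p, ∑ q, J i p * J j q * pderiv p (pderiv q f) (T z) := by
    intro i j
    have hev : pderiv j (fun x => f (T x)) =ᶠ[𝓝[halfSpace n] z] fun x =>
        ∑ a, pderiv j (fun x => T x a) x * pderiv a f (T x) := by
      rw [hw]
      filter_upwards [hfe, hT, eventually_pos hz, hpos'] with x h1 h2 h3 h4
      exact pderiv_comp h1 h2 h3 h4 j
    have hfs : ∀ a, SmoothNear (fun x => pderiv a f (T x)) z := fun a =>
      (hf.pderiv a).comp hT hz hTz
    rw [pderiv_congr hzH hev, pderiv_sum _ hzH fun a => (hJs j a).mul (hfs a)]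
    rw [Finset.sum_comm (f := fun p q => J i p * J j q * pderiv p (pderiv q f) (T z)),
      ← Finset.sum_add_distrib]
    refine Finset.sum_congr rfl fun a _ => ?_
    rw [pderiv_mul hzH (hJs j a) (hfs a), pderiv_comp (hf.pderiv a) hT.self_of_nhds hz hTz,
      add_comm, Finset.mul_sum]
    congr 1
    exact Finset.sum_congr rfl fun b _ => by simp only [hJ, Matrix.of_apply]; ring
  have hterm : ∀ i j, pderiv i (pderiv j fun x => f (T x)) z
        - ∑ k, christoffel G' k i j z * pderiv k (fun x => f (T x)) z
      = ∑ p, ∑ q, (J i p * J j q) * (pderiv p (pderiv q f) (T z)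
        - ∑ k, christoffel G k p q (T z) * pderiv k f (T z)) := by
    intro i j
    have e1 : ∑ k, christoffel G' k i j z * pderiv k (fun x => f (T x)) z
        = ∑ d, (∑ k, J k d * christoffel G' k i j z) * pderiv d f (T z) := by
      simp_rw [hd1, Finset.mul_sum, Finset.sum_mul]
      rw [Finset.sum_comm]
      exact Finset.sum_congr rfl fun a _ => Finset.sum_congr rfl fun b _ => by ring
    have e2 : ∑ d, (∑ p, ∑ q, J i p * J j q * christoffel G d p q (T z)) * pderiv d f (T z)
        = ∑ p, ∑ q, J i p * J j q * ∑ k, christoffel G k p q (T z) * pderiv k f (T z) := by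
      simp_rw [Finset.mul_sum, Finset.sum_mul]
      conv_rhs => rw [Finset.sum_comm_cycle]
      exact Finset.sum_congr rfl fun a _ => Finset.sum_congr rfl fun b _ =>
        Finset.sum_congr rfl fun c _ => by ring
    rw [e1, hd2]
    simp_rw [hΓ, add_mul, mul_sub, Finset.sum_add_distrib, Finset.sum_sub_distrib]
    rw [e2]
    ring
  simp only [laplace, hterm, ← hinv, Finset.mul_sum, Finset.sum_mul]
  congr 1
  rw [Finset.sum_comm_cycle]
  refine Finset.sum_congr rfl fun p _ => ?_
  rw [Finset.sum_comm_cycle]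
  exact Finset.sum_congr rfl fun q _ => Finset.sum_congr rfl fun i _ =>
    Finset.sum_congr rfl fun j _ => by ring

end ChangeOfCoordinates

/-! ### The Hopf boundary point lemma in coordinates -/

section Hopf

variable {n : ℕ} [NeZero n] {G : EuclideanSpace ℝ (Fin n) → Matrix (Fin n) (Fin n) ℝ}
  {f h : EuclideanSpace ℝ (Fin n) → ℝ} {y q : EuclideanSpace ℝ (Fin n)}

lemma MetricNear.smooth_laplace (hG : MetricNear G y) (hf : SmoothNear f y) :
    SmoothNear (laplace G f) y :=
  (SmoothNear.sum _ fun i => SmoothNear.sum _ fun j => (hG.smooth_inv i j).mul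
    (((hf.pderiv j).pderiv i).sub (SmoothNear.sum _ fun k =>
      (hG.smooth_christoffel k i j).mul (hf.pderiv k)))).neg

@[simp] lemma laplace_const (c : ℝ) : laplace G (fun _ => c) y = 0 := by
  have : ∀ j, pderiv j (fun _ : EuclideanSpace ℝ (Fin n) => c) = fun _ => 0 := fun j =>
    funext fun z => pderiv_const c j
  simp [laplace, this]

lemma laplace_sub_const_mul_add_const (hf : SmoothNear f y) (hh : SmoothNear h y)
    (hy : y ∈ halfSpace n) (c d : ℝ) :
    laplace G (fun z => f z - c * h z + d) y = laplace G f y - c * laplace G h y := by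
  have h1 : ∀ {z : EuclideanSpace ℝ (Fin n)}, z ∈ halfSpace n → SmoothNear f z → SmoothNear h z →
      ∀ i, pderiv i (fun z => f z - c * h z + d) z = pderiv i f z - c * pderiv i h z := by
    intro z hz a b i
    rw [pderiv_add hz (a.sub (b.const_mul c)) (SmoothNear.const d), pderiv_const, add_zero,
      pderiv_sub hz a (b.const_mul c), pderiv_const_mul hz c b]
  have h2 : ∀ i j, pderiv i (pderiv j fun z => f z - c * h z + d) y =
      pderiv i (pderiv j f) y - c * pderiv i (pderiv j h) y := by
    intro i j
    have hev : pderiv j (fun z => f z - c * h z + d) =ᶠ[𝓝[halfSpace n] y]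
        fun z => pderiv j f z - c * pderiv j h z := by
      filter_upwards [hf.eventually, hh.eventually, self_mem_nhdsWithin] with z a b e
      exact h1 e a b j
    rw [pderiv_congr hy hev, pderiv_sub hy (hf.pderiv j) ((hh.pderiv j).const_mul c),
      pderiv_const_mul hy c (hh.pderiv j)]
  have h3 : ∀ i j, ∑ k, christoffel G k i j y * (pderiv k f y - c * pderiv k h y) =
      ∑ k, christoffel G k i j y * pderiv k f y
        - c * ∑ k, christoffel G k i j y * pderiv k h y := by
    intro i j
    rw [Finset.mul_sum, ← Finset.sum_sub_distrib]
    exact Finset.sum_congr rfl fun k _ => by ring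
  simp only [laplace, h2, h1 hy hf hh, h3]
  rw [mul_neg, sub_neg_eq_add, neg_add_eq_sub, ← neg_sub, neg_inj, Finset.mul_sum,
    ← Finset.sum_sub_distrib]
  refine Finset.sum_congr rfl fun i _ => ?_
  rw [Finset.mul_sum, ← Finset.sum_sub_distrib]
  exact Finset.sum_congr rfl fun j _ => by ring

lemma smoothNear_norm_sub_sq : SmoothNear (fun z => ‖z - q‖ ^ 2) y :=
  Filter.Eventually.of_forall fun _ =>
    ((contDiff_id.sub contDiff_const).norm_sq ℝ).contDiffAt.contDiffWithinAt

lemma fderivWithin_norm_sub_sq (hy : y ∈ halfSpace n) (v : EuclideanSpace ℝ (Fin n)) :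
    fderivWithin ℝ (fun z => ‖z - q‖ ^ 2) (halfSpace n) y v = 2 * inner ℝ (y - q) v := by
  have : HasFDerivAt (fun z => ‖z - q‖ ^ 2) _ y := ((hasFDerivAt_id y).sub_const q).norm_sq
  rw [this.hasFDerivWithinAt.fderivWithin (uniqueDiffOn_halfSpace y hy)]
  simp [inner_sub_left]

/-- The squared length of the gradient is positive where the gradient is not zero. -/
lemma MetricNear.sum_pderiv_mul_gradient_pos (hG : MetricNear G y) (hy : y ∈ halfSpace n)
    (hne : ∃ i, pderiv i f y ≠ 0) : 0 < ∑ k, pderiv k f y * gradient G f k y := by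
  have hx : (fun i => pderiv i f y) ≠ 0 := by
    obtain ⟨i, hi⟩ := hne
    exact fun h0 => hi (congrFun h0 i)
  have := (hG.posDef_self hy).inv.dotProduct_mulVec_pos hx
  simpa [dotProduct, Matrix.mulVec, gradient] using this

/-- For `α` large, `e^{-α |y - q|²}` is strictly subharmonic on a compact set that does not
contain `q`. -/
lemma exists_laplace_exp_neg {A : Set (EuclideanSpace ℝ (Fin n))} (hA : IsCompact A)
    (hAH : A ⊆ halfSpace n) (hq : q ∉ A) (hG : ∀ y ∈ A, MetricNear G y) :
    ∃ α : ℝ, 0 < α ∧ ∀ y ∈ A, laplace G (fun z => Real.exp (-α * ‖z - q‖ ^ 2)) y < 0 := by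
  set s : EuclideanSpace ℝ (Fin n) → ℝ := fun z => ‖z - q‖ ^ 2 with hs
  have hss : ∀ y, SmoothNear s y := fun y => smoothNear_norm_sub_sq
  set W : EuclideanSpace ℝ (Fin n) → ℝ := fun y => ∑ k, pderiv k s y * gradient G s k y with hW
  have hWpos : ∀ y ∈ A, 0 < W y := by
    intro y hyA
    refine (hG y hyA).sum_pderiv_mul_gradient_pos (hAH hyA) ?_
    by_contra! hall
    have h1 := fderivWithin_norm_sub_sq (q := q) (hAH hyA) (y - q)
    rw [fderivWithin_apply_eq_sum] at h1
    simp only [← hs, hall, mul_zero, Finset.sum_const_zero, real_inner_self_eq_norm_sq] at h1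
    have h2 : ‖y - q‖ = 0 := by nlinarith [norm_nonneg (y - q)]
    rw [norm_eq_zero, sub_eq_zero] at h2
    exact hq (h2 ▸ hyA)
  have hcont : ContinuousOn (fun y => -laplace G s y / W y) A := by
    intro y hyA
    refine ContinuousWithinAt.div ?_ ?_ (hWpos y hyA).ne'
    · exact (((hG y hyA).smooth_laplace (hss y)).neg.continuousWithinAt (hAH hyA)).mono hAH
    · exact ((SmoothNear.sum _ fun k => ((hss y).pderiv k).mul
        ((hG y hyA).smooth_gradient (hss y) k)).continuousWithinAt (hAH hyA)).mono hAH
  obtain ⟨C, hC⟩ := (hA.image_of_continuousOn hcont).bddAbove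
  refine ⟨max C 0 + 1, by positivity, fun y hyA => ?_⟩
  set α := max C 0 + 1
  have hα : -laplace G s y / W y < α :=
    (hC ⟨y, hyA, rfl⟩).trans_lt ((le_max_left C 0).trans_lt (lt_add_one _))
  have hα0 : 0 < α := by positivity
  rw [div_lt_iff₀ (hWpos y hyA)] at hα
  have key := ((hG y hyA).laplace_const_mul_exp_mul (hss y) (SmoothNear.const 1) (hAH hyA) 1 α).2
  simp only [one_mul, mul_one, laplace_const, pderiv_const, mul_zero, Finset.sum_const_zero,
    add_zero, zero_sub] at key
  rw [key]
  have := Real.exp_pos (-α * s y)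
  refine mul_neg_of_pos_of_neg this ?_
  have : 0 < α * (laplace G s y + α * W y) := by
    apply mul_pos hα0
    linarith
  simp only [hW] at this ⊢
  nlinarith

/-- Hopf's boundary point lemma: a superharmonic function that is positive in a ball and vanishes
at a boundary point of this ball is not critical there. -/
lemma hopf {r : ℝ} {p : EuclideanSpace ℝ (Fin n)} (hr : 0 < r)
    (hH : Metric.closedBall q r ⊆ halfSpace n) (hpos : ∀ y ∈ Metric.ball q r, 0 < y 0)
    (hG : ∀ y ∈ Metric.closedBall q r, MetricNear G y)
    (hf : ∀ y ∈ Metric.closedBall q r, SmoothNear f y)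
    (hf0 : ∀ y ∈ Metric.closedBall q r, 0 ≤ f y) (hfpos : ∀ y ∈ Metric.ball q r, 0 < f y)
    (hlap : ∀ y ∈ Metric.ball q r, 0 ≤ laplace G f y) (hp : dist p q = r) (hfp : f p = 0) :
    ∃ v, fderivWithin ℝ f (halfSpace n) p v ≠ 0 := by
  set A := Metric.closedBall q r \ Metric.ball q (r / 2) with hAdef
  have hAc : IsCompact A := (isCompact_closedBall q r).diff Metric.isOpen_ball
  have hAB : A ⊆ Metric.closedBall q r := Set.sdiff_subset
  have hqA : q ∉ A := fun h => h.2 (Metric.mem_ball_self (by positivity))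
  obtain ⟨α, hα, hlapα⟩ := exists_laplace_exp_neg hAc (hAB.trans hH) hqA
    fun y hy => hG y (hAB hy)
  set b : EuclideanSpace ℝ (Fin n) → ℝ := fun z => Real.exp (-α * ‖z - q‖ ^ 2) with hb
  have hbs : ∀ y, SmoothNear b y := fun y => (smoothNear_norm_sub_sq.const_mul _).exp
  -- a positive lower bound for `f` on the inner sphere
  set m := p + (1 / 2 : ℝ) • (q - p) with hm
  have hpq : ‖p - q‖ = r := by rw [← dist_eq_norm, hp]
  have hmdist : ∀ t : ℝ, 0 ≤ t → t ≤ 1 → dist (p + t • (q - p)) q = (1 - t) * r := by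
    intro t ht0 ht1
    have : p + t • (q - p) - q = (1 - t) • (p - q) := by module
    rw [dist_eq_norm, this, norm_smul, hpq, Real.norm_of_nonneg (by linarith)]
  have hmS : m ∈ Metric.sphere q (r / 2) := by
    rw [Metric.mem_sphere, hmdist _ (by norm_num) (by norm_num)]
    ring
  have hSB : Metric.sphere q (r / 2) ⊆ Metric.ball q r := fun y hy => by
    rw [Metric.mem_sphere] at hy
    rw [Metric.mem_ball, hy]
    linarith
  have hfc : ∀ S ⊆ Metric.closedBall q r, ContinuousOn f S := fun S hS y hy =>
    ((hf y (hS hy)).continuousWithinAt (hH (hS hy))).mono (hS.trans hH)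
  obtain ⟨y₁, hy₁, hmin₁⟩ := (isCompact_sphere q (r / 2)).exists_isMinOn ⟨m, hmS⟩
    (hfc _ (hSB.trans Metric.ball_subset_closedBall))
  set ε := f y₁ / 2 with hε
  have hfy₁ : 0 < f y₁ := hfpos y₁ (hSB hy₁)
  have hε0 : 0 < ε := by positivity
  -- comparison of `f` with the barrier
  set c := Real.exp (-α * r ^ 2) with hc
  set v : EuclideanSpace ℝ (Fin n) → ℝ := fun z => f z - ε * b z + ε * c with hv
  have hvs : ∀ y ∈ Metric.closedBall q r, SmoothNear v y := fun y hy =>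
    ((hf y hy).sub ((hbs y).const_mul ε)).add (SmoothNear.const _)
  have hpB : p ∈ Metric.closedBall q r := by rw [Metric.mem_closedBall, hp]
  have hsegA : ∀ t : ℝ, 0 ≤ t → t ≤ 1 / 2 → p + t • (q - p) ∈ A := by
    intro t ht0 ht1
    refine ⟨?_, ?_⟩
    · rw [Metric.mem_closedBall, hmdist t ht0 (by linarith)]
      nlinarith
    · rw [Metric.mem_ball, hmdist t ht0 (by linarith)]
      nlinarith
  have hpA : p ∈ A := by simpa using hsegA 0 le_rfl (by norm_num)
  have hvp : v p = 0 := by simp [hv, hb, hc, hfp, hpq]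
  -- a negative minimum of `v` over the annulus `A` would lie in its interior, where the Laplacian of
  -- `v` is positive
  have hvA : ∀ y ∈ A, 0 ≤ v y := by
    obtain ⟨y₀, hy₀, hmin⟩ := hAc.exists_isMinOn ⟨p, hpA⟩ (f := v) fun y hy =>
      ((hvs y (hAB hy)).continuousWithinAt (hH (hAB hy))).mono (hAB.trans hH)
    suffices h0 : 0 ≤ v y₀ from fun y hy => h0.trans (hmin hy)
    by_contra! hneg
    have hd1 : dist y₀ q ≤ r := hAB hy₀
    have hd2 : r / 2 ≤ dist y₀ q := not_lt.1 hy₀.2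
    have hd3 : dist y₀ q ≠ r := by
      intro h0
      have : b y₀ = c := by simp only [hb, hc, ← dist_eq_norm, h0]
      have h2 := hf0 y₀ (hAB hy₀)
      simp only [hv, this] at hneg
      linarith
    have hd4 : dist y₀ q ≠ r / 2 := by
      intro h0
      have h2 : f y₁ ≤ f y₀ := hmin₁ h0
      have h3 : b y₀ ≤ 1 := by
        rw [hb, Real.exp_le_one_iff]
        nlinarith [sq_nonneg ‖y₀ - q‖]
      have h4 : 0 < c := Real.exp_pos _
      simp only [hv] at hneg
      nlinarith
    have hball : y₀ ∈ Metric.ball q r := lt_of_le_of_ne hd1 hd3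
    have hnhds : A ∈ 𝓝 y₀ := by
      have hopen : IsOpen (Metric.ball q r \ Metric.closedBall q (r / 2)) :=
        Metric.isOpen_ball.sdiff Metric.isClosed_closedBall
      refine Filter.mem_of_superset (hopen.mem_nhds ⟨hball, ?_⟩) ?_
      · rw [Metric.mem_closedBall, not_le]
        exact lt_of_le_of_ne hd2 hd4.symm
      · exact Set.sdiff_subset_sdiff Metric.ball_subset_closedBall Metric.ball_subset_closedBall
    have hy₀pos := hpos y₀ hball
    have h5 := (hG y₀ (hAB hy₀)).laplace_nonpos (hvs y₀ (hAB hy₀)) hy₀pos (hmin.isLocalMin hnhds)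
    rw [laplace_sub_const_mul_add_const (hf y₀ (hAB hy₀)) (hbs y₀) hy₀pos.le] at h5
    have h6 := hlap y₀ hball
    have h7 := hlapα y₀ hy₀
    nlinarith
  -- the derivative of `v` in the direction of the centre is nonnegative at `p`
  have hpH := hH hpB
  have hvmin : IsLocalMinOn v A p := IsMinOn.localize fun y hy => by
    simpa only [Set.mem_ofPred_eq, hvp] using hvA y hy
  have hvd := ((hvs p hpB).differentiableWithinAt hpH).hasFDerivWithinAt
  have hcone : m - p ∈ posTangentConeAt A p := by
    refine sub_mem_posTangentConeAt_of_segment_subset fun x hx => ?_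
    rw [segment_eq_image'] at hx
    obtain ⟨t, ⟨ht0, ht1⟩, rfl⟩ := hx
    have := hsegA (t * (1 / 2)) (by positivity) (by linarith)
    simpa [hm, smul_smul] using this
  have h1 := hvmin.hasFDerivWithinAt_nonneg (hvd.mono (hAB.trans hH)) hcone
  have h2 : fderivWithin ℝ v (halfSpace n) p (m - p) =
      fderivWithin ℝ f (halfSpace n) p (m - p) - ε * (α * r ^ 2 * c) := by
    have hud := uniqueDiffOn_halfSpace p hpH
    have hsd := (smoothNear_norm_sub_sq (q := q) (y := p)).differentiableWithinAt hpH
    have hbd : HasFDerivWithinAt b _ (halfSpace n) p := (hsd.hasFDerivWithinAt.const_mul (-α)).exp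
    have hvd' : HasFDerivWithinAt v _ (halfSpace n) p :=
      ((((hf p hpB).differentiableWithinAt hpH).hasFDerivWithinAt).sub
        (hbd.const_mul ε)).add_const (ε * c)
    rw [hvd'.fderivWithin hud]
    have hin : inner ℝ (p - q) (m - p) = -(r ^ 2) / 2 := by
      have : m - p = (-(1 / 2) : ℝ) • (p - q) := by rw [hm]; module
      rw [this, inner_smul_right, real_inner_self_eq_norm_sq, hpq]
      ring
    simp only [sub_apply, smul_apply, smul_eq_mul,
      fderivWithin_norm_sub_sq hpH, hin, hpq, ← hc]
    ring
  have hc0 : 0 < c := Real.exp_pos _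
  refine ⟨m - p, ne_of_gt ?_⟩
  rw [h2] at h1
  have : 0 < ε * (α * r ^ 2 * c) := by positivity
  linarith

end Hopf

/-! ### Metrics and functions on a manifold, read in a chart -/

section Charts

variable {n : ℕ} [NeZero n] {M : Type*} [TopologicalSpace M]
  [ChartedSpace (EuclideanHalfSpace n) M]

lemma range_model : Set.range (𝓡∂ n) = halfSpace n := range_modelWithCornersEuclideanHalfSpace n

lemma target_subset_halfSpace (x : M) : (extChartAt (𝓡∂ n) x).target ⊆ halfSpace n := by
  rw [← range_model]
  exact extChartAt_target_subset_range x

lemma target_mem_nhdsWithin {x : M} {y : EuclideanSpace ℝ (Fin n)}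
    (hy : y ∈ (extChartAt (𝓡∂ n) x).target) :
    (extChartAt (𝓡∂ n) x).target ∈ 𝓝[halfSpace n] y := by
  rw [← range_model]
  exact extChartAt_target_mem_nhdsWithin_of_mem hy

lemma coord_mem_target (x : M) : coord x ∈ (extChartAt (𝓡∂ n) x).target :=
  mem_extChartAt_target x

lemma symm_coord (x : M) : (extChartAt (𝓡∂ n) x).symm (coord x) = x := extChartAt_to_inv x

lemma smoothNear_of_contDiffOn_target {x : M} {F : EuclideanSpace ℝ (Fin n) → ℝ}
    {y : EuclideanSpace ℝ (Fin n)} (hF : ContDiffOn ℝ ∞ F (extChartAt (𝓡∂ n) x).target)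
    (hy : y ∈ (extChartAt (𝓡∂ n) x).target) : SmoothNear F y := by
  filter_upwards [target_mem_nhdsWithin hy] with z hz
  exact (hF z hz).mono_of_mem_nhdsWithin (target_mem_nhdsWithin hz)

lemma sum_smul_chartVec (x : M) (y : EuclideanSpace ℝ (Fin n)) (c : EuclideanSpace ℝ (Fin n)) :
    mfderivWithin 𝓘(ℝ, EuclideanSpace ℝ (Fin n)) (𝓡∂ n) (extChartAt (𝓡∂ n) x).symm
      (halfSpace n) y c = ∑ i, c i • chartVec x i y := by
  have hc : c = ∑ i, c i • (coordVec i : EuclideanSpace ℝ (Fin n)) := by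
    ext j
    simp [coordVec, Pi.single_apply]
  conv_lhs => rw [hc]
  simp only [chartVec]
  exact (map_sum _ _ _).trans (Finset.sum_congr rfl fun i _ => map_smul _ _ _)

variable [IsManifold (𝓡∂ n) ∞ M]

lemma smoothNear_inChart {u : M → ℝ} (hu : ContMDiff (𝓡∂ n) 𝓘(ℝ, ℝ) ∞ u) {x : M}
    {y : EuclideanSpace ℝ (Fin n)} (hy : y ∈ (extChartAt (𝓡∂ n) x).target) :
    SmoothNear (inChart u x) y :=
  smoothNear_of_contDiffOn_target (contMDiffOn_iff_contDiffOn.1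
    (hu.comp_contMDiffOn (contMDiffOn_extChartAt_symm x))) hy

/-- The coordinate fields are smooth sections of the tangent bundle over the chart. -/
lemma contMDiffOn_chartVec (x : M) (i : Fin n) :
    ContMDiffOn 𝓘(ℝ, EuclideanSpace ℝ (Fin n)) (𝓡∂ n).tangent ∞
      (fun y => (⟨(extChartAt (𝓡∂ n) x).symm y, chartVec x i y⟩ : TangentBundle (𝓡∂ n) M))
      (extChartAt (𝓡∂ n) x).target := by
  have h1 := (contMDiffOn_extChartAt_symm (I := 𝓡∂ n) (n := ∞) x).contMDiffOn_tangentMapWithin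
    (m := ∞) le_rfl (uniqueMDiffOn_iff_uniqueDiffOn.2 (uniqueDiffOn_extChartAt_target x))
  have h2 : ContMDiff 𝓘(ℝ, EuclideanSpace ℝ (Fin n))
      (𝓘(ℝ, EuclideanSpace ℝ (Fin n))).tangent ∞
      (fun y : EuclideanSpace ℝ (Fin n) => (⟨y, coordVec i⟩ :
        TangentBundle 𝓘(ℝ, EuclideanSpace ℝ (Fin n)) (EuclideanSpace ℝ (Fin n)))) :=
    contMDiff_vectorSpace_iff_contDiff.2 contDiff_const
  refine (h1.comp h2.contMDiffOn fun y hy => hy).congr fun y hy => ?_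
  simp only [Function.comp_apply, tangentMapWithin, chartVec]
  congr 2
  refine mfderivWithin_congr_set ?_
  filter_upwards [mem_nhdsWithin_iff_eventually.1 (target_mem_nhdsWithin hy)] with z hz
  exact propext ⟨fun h => hz h, fun h => target_subset_halfSpace x h⟩

lemma contDiffOn_gram (g : Metric n M) (x : M) (i j : Fin n) :
    ContDiffOn ℝ ∞ (fun y => gram g x y i j) (extChartAt (𝓡∂ n) x).target := by
  have h := ContMDiffOn.clm_bundle_apply₂ (F₁ := EuclideanSpace ℝ (Fin n))
    (F₂ := EuclideanSpace ℝ (Fin n)) (F₃ := ℝ) (E₁ := fun m : M => TangentSpace (𝓡∂ n) m)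
    (E₂ := fun m : M => TangentSpace (𝓡∂ n) m) (E₃ := Bundle.Trivial M ℝ)
    (b := (extChartAt (𝓡∂ n) x).symm)
    (g.contMDiff.comp_contMDiffOn (contMDiffOn_extChartAt_symm x))
    (contMDiffOn_chartVec x i) (contMDiffOn_chartVec x j)
  intro y hy
  have h1 := h y hy
  rw [Bundle.contMDiffWithinAt_totalSpace] at h1
  exact contMDiffWithinAt_iff_contDiffWithinAt.1 h1.2

lemma bilinear_sum_sum {V : Type*} [TopologicalSpace V] [AddCommGroup V] [Module ℝ V]
    {ι : Type*} [Fintype ι] (B : V →L[ℝ] V →L[ℝ] ℝ) (X : ι → V) (c d : ι → ℝ) :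
    B (∑ i, c i • X i) (∑ i, d i • X i) = ∑ i, ∑ j, c i * d j * B (X i) (X j) := by
  rw [map_sum B, sum_apply]
  refine Finset.sum_congr rfl fun i _ => ?_
  rw [map_sum]
  refine Finset.sum_congr rfl fun j _ => ?_
  rw [map_smul, map_smul, smul_apply, smul_eq_mul, smul_eq_mul]
  ring

/-- The metric paired with combinations of the coordinate fields. -/
lemma inner_sum_chartVec (g : Metric n M) (x : M) (y : EuclideanSpace ℝ (Fin n)) (c d : Fin n → ℝ) :
    g.inner ((extChartAt (𝓡∂ n) x).symm y) (∑ i, c i • chartVec x i y) (∑ i, d i • chartVec x i y)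
      = ∑ i, ∑ j, c i * d j * gram g x y i j :=
  bilinear_sum_sum _ _ _ _

lemma gram_posDef (g : Metric n M) {x : M} {y : EuclideanSpace ℝ (Fin n)}
    (hy : y ∈ (extChartAt (𝓡∂ n) x).target) : (gram g x y).PosDef := by
  refine Matrix.PosDef.of_dotProduct_mulVec_pos ?_ fun c hc => ?_
  · ext i j
    simp only [Matrix.conjTranspose_apply, gram, Matrix.of_apply, star_trivial]
    exact g.symm _ _ _
  · have hinj : (mfderivWithin 𝓘(ℝ, EuclideanSpace ℝ (Fin n)) (𝓡∂ n)
        (extChartAt (𝓡∂ n) x).symm (halfSpace n) y).IsInvertible := by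
      have := isInvertible_mfderivWithin_extChartAt_symm (I := 𝓡∂ n) hy
      rwa [range_model] at this
    have hne : ∑ i, c i • chartVec x i y ≠ 0 := by
      intro h0
      have h1 := sum_smul_chartVec x y (WithLp.toLp 2 c)
      rw [show ∑ i, (WithLp.toLp 2 c : EuclideanSpace ℝ (Fin n)) i • chartVec x i y = 0 from h0]
        at h1
      have h2 := hinj.injective (h1.trans (map_zero _).symm)
      exact hc (congrArg WithLp.ofLp h2)
    have := g.pos _ _ hne
    rw [inner_sum_chartVec] at this
    simpa [dotProduct, Matrix.mulVec, Finset.mul_sum, mul_assoc, mul_comm, mul_left_comm]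
      using this

lemma metricNear_gram (g : Metric n M) {x : M} {y : EuclideanSpace ℝ (Fin n)}
    (hy : y ∈ (extChartAt (𝓡∂ n) x).target) : MetricNear (gram g x) y where
  smooth i j := smoothNear_of_contDiffOn_target (contDiffOn_gram g x i j) hy
  posDef := by
    filter_upwards [target_mem_nhdsWithin hy] with z hz using gram_posDef g hz

/-- The metric in two charts: `gram g x` is the pull-back of `gram g p` under the change of
coordinates. -/
lemma gram_eq_pullback (g : Metric n M) {x p : M} {z : EuclideanSpace ℝ (Fin n)}
    (hz : z ∈ ((extChartAt (𝓡∂ n) x).symm ≫ extChartAt (𝓡∂ n) p).source) (i j : Fin n) :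
    gram g x z i j = ∑ a, ∑ b,
      pderiv i (fun y => extChartAt (𝓡∂ n) p ((extChartAt (𝓡∂ n) x).symm y) a) z *
      pderiv j (fun y => extChartAt (𝓡∂ n) p ((extChartAt (𝓡∂ n) x).symm y) b) z *
      gram g p (extChartAt (𝓡∂ n) p ((extChartAt (𝓡∂ n) x).symm z)) a b := by
  set T : EuclideanSpace ℝ (Fin n) → EuclideanSpace ℝ (Fin n) := fun y =>
    extChartAt (𝓡∂ n) p ((extChartAt (𝓡∂ n) x).symm y) with hTdef
  rw [PartialEquiv.trans_source, PartialEquiv.symm_source] at hz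
  obtain ⟨hz1, hz2⟩ := hz
  have hzH := target_subset_halfSpace x hz1
  have hTH : ∀ y, T y ∈ halfSpace n := fun y => by
    rw [← range_model]
    exact ⟨_, rfl⟩
  have hTz : T z ∈ (extChartAt (𝓡∂ n) p).target := (extChartAt (𝓡∂ n) p).map_source hz2
  have hinv : (extChartAt (𝓡∂ n) p).symm (T z) = (extChartAt (𝓡∂ n) x).symm z :=
    (extChartAt (𝓡∂ n) p).left_inv hz2
  have hTd : DifferentiableWithinAt ℝ T (halfSpace n) z := by
    have := contDiffWithinAt_ext_coord_change (I := 𝓡∂ n) (n := ∞) p x (y := z)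
      (by rw [PartialEquiv.trans_source, PartialEquiv.symm_source]; exact ⟨hz1, hz2⟩)
    rw [range_model] at this
    exact this.differentiableWithinAt (by simp)
  have hud := uniqueDiffOn_halfSpace z hzH
  have hmd : ∀ {p : M} {y : EuclideanSpace ℝ (Fin n)}, y ∈ (extChartAt (𝓡∂ n) p).target →
      MDifferentiableWithinAt 𝓘(ℝ, EuclideanSpace ℝ (Fin n)) (𝓡∂ n)
        (extChartAt (𝓡∂ n) p).symm (halfSpace n) y := by
    intro p y hy
    exact ((contMDiffOn_extChartAt_symm (I := 𝓡∂ n) (n := ∞) p y hy).mdifferentiableWithinAt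
      (by simp)).mono_of_mem_nhdsWithin (target_mem_nhdsWithin hy)
  -- the chain rule
  have hev : (extChartAt (𝓡∂ n) x).symm =ᶠ[𝓝[halfSpace n] z]
      (extChartAt (𝓡∂ n) p).symm ∘ T := by
    have hc := (hmd hz1).continuousWithinAt
    filter_upwards [hc.preimage_mem_nhdsWithin (extChartAt_source_mem_nhds' (I := 𝓡∂ n) hz2)]
      with y hy
    exact ((extChartAt (𝓡∂ n) p).left_inv hy).symm
  have hchain : ∀ v : EuclideanSpace ℝ (Fin n),
      (mfderivWithin 𝓘(ℝ, EuclideanSpace ℝ (Fin n)) (𝓡∂ n) (extChartAt (𝓡∂ n) x).symm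
        (halfSpace n) z v : EuclideanSpace ℝ (Fin n)) =
      mfderivWithin 𝓘(ℝ, EuclideanSpace ℝ (Fin n)) (𝓡∂ n) (extChartAt (𝓡∂ n) p).symm
        (halfSpace n) (T z) (fderivWithin ℝ T (halfSpace n) z v) := by
    intro v
    have h1 := hev.mfderivWithin_eq (hev.self_of_nhdsWithin hzH)
      (I := 𝓘(ℝ, EuclideanSpace ℝ (Fin n))) (I' := 𝓡∂ n)
    have h2 := mfderivWithin_comp (I := 𝓘(ℝ, EuclideanSpace ℝ (Fin n)))
      (I' := 𝓘(ℝ, EuclideanSpace ℝ (Fin n))) (I'' := 𝓡∂ n) z (hmd hTz)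
      hTd.mdifferentiableWithinAt (fun y _ => hTH y) hud.uniqueMDiffWithinAt
    rw [mfderivWithin_eq_fderivWithin] at h2
    have h3 := h1.trans h2
    exact DFunLike.congr_fun h3 v
  have hpd : ∀ i a, pderiv i (fun y => T y a) z =
      fderivWithin ℝ T (halfSpace n) z (coordVec i) a := by
    intro i a
    have : HasFDerivWithinAt (fun y => T y a) _ (halfSpace n) z :=
      (EuclideanSpace.proj a : EuclideanSpace ℝ (Fin n) →L[ℝ] ℝ).hasFDerivAt.comp_hasFDerivWithinAt
        z hTd.hasFDerivWithinAt
    rw [pderiv, this.fderivWithin hud]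
    rfl
  have hvec : ∀ i, (chartVec x i z : EuclideanSpace ℝ (Fin n)) =
      ∑ a, pderiv i (fun y => T y a) z • (chartVec p a (T z) : EuclideanSpace ℝ (Fin n)) := by
    intro i
    simp only [hpd]
    exact (hchain (coordVec i)).trans (sum_smul_chartVec p (T z) _)
  have hm : ∀ {m m' : M}, m = m' → ∀ X Y : EuclideanSpace ℝ (Fin n),
      g.inner m X Y = g.inner m' X Y := by
    rintro m _ rfl X Y
    rfl
  rw [← inner_sum_chartVec]
  refine (hm hinv.symm (chartVec x i z) (chartVec x j z)).trans ?_
  exact congrArg₂ (fun X Y : EuclideanSpace ℝ (Fin n) =>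
    g.inner ((extChartAt (𝓡∂ n) p).symm (T z)) X Y) (hvec i) (hvec j)

end Charts

/-! ### The maximum principle on the manifold -/

section MaximumPrinciple

variable {n : ℕ} [NeZero n] {M : Type*} [TopologicalSpace M]
  [ChartedSpace (EuclideanHalfSpace n) M]

lemma laplace_congr {G : EuclideanSpace ℝ (Fin n) → Matrix (Fin n) (Fin n) ℝ}
    {f f' : EuclideanSpace ℝ (Fin n) → ℝ} {y : EuclideanSpace ℝ (Fin n)} (hy : y ∈ halfSpace n)
    (h : f =ᶠ[𝓝[halfSpace n] y] f') : laplace G f y = laplace G f' y := by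
  have h1 : ∀ k, pderiv k f y = pderiv k f' y := pderiv_congr hy h
  have h2 : ∀ i j, pderiv i (pderiv j f) y = pderiv i (pderiv j f') y := fun i j =>
    pderiv_congr hy (pderiv_congr_eventually h j) i
  simp only [laplace, h1, h2]

lemma coord_pos_of_isInteriorPoint {x : M} (hx : (𝓡∂ n).IsInteriorPoint x) :
    0 < (coord x : EuclideanSpace ℝ (Fin n)) 0 := by
  have h : extChartAt (𝓡∂ n) x x ∈ interior (Set.range (𝓡∂ n)) := hx
  rw [interior_range_modelWithCornersEuclideanHalfSpace] at h
  exact h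

lemma coord_eq_zero_of_mem_bdry {x : M} (hx : x ∈ Bdry n M) :
    (coord x : EuclideanSpace ℝ (Fin n)) 0 = 0 := by
  have h : extChartAt (𝓡∂ n) x x ∈ frontier (Set.range (𝓡∂ n)) := hx
  rw [frontier_range_modelWithCornersEuclideanHalfSpace] at h
  exact h.symm

lemma mem_bdry_of_coord_eq_zero {x : M} (hx : (coord x : EuclideanSpace ℝ (Fin n)) 0 = 0) :
    x ∈ Bdry n M := by
  show extChartAt (𝓡∂ n) x x ∈ frontier (Set.range (𝓡∂ n))
  rw [frontier_range_modelWithCornersEuclideanHalfSpace]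
  exact hx.symm

lemma tendsto_symm_coord (x : M) :
    Filter.Tendsto (extChartAt (𝓡∂ n) x).symm (𝓝[halfSpace n] (coord x)) (𝓝 x) := by
  have h := (continuousAt_extChartAt_symm (I := 𝓡∂ n) x).tendsto
  rw [extChartAt_to_inv] at h
  exact h.mono_left nhdsWithin_le_nhds

lemma isLocalMinOn_inChart {v : M → ℝ} {x : M} (h : IsLocalMin v x) :
    IsLocalMinOn (inChart v x) (halfSpace n) (coord x : EuclideanSpace ℝ (Fin n)) := by
  have := (tendsto_symm_coord (n := n) x).eventually h
  simpa only [IsLocalMinOn, IsMinFilter, inChart, symm_coord] using this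

variable [IsManifold (𝓡∂ n) ∞ M] (g : Metric n M) {v : M → ℝ}

lemma isInteriorPoint_symm {p : M} {y : EuclideanSpace ℝ (Fin n)}
    (hy : y ∈ (extChartAt (𝓡∂ n) p).target) (hy0 : 0 < y 0) :
    (𝓡∂ n).IsInteriorPoint ((extChartAt (𝓡∂ n) p).symm y) := by
  have hs := (extChartAt (𝓡∂ n) p).map_target hy
  rw [extChartAt_source] at hs
  rw [ModelWithCorners.isInteriorPoint_iff_of_mem_atlas (n := ∞) (by simp)
    (chart_mem_atlas _ p) hs]
  show extChartAt (𝓡∂ n) p _ ∈ interior (extChartAt (𝓡∂ n) p).target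
  rw [(extChartAt (𝓡∂ n) p).right_inv hy, mem_interior_iff_mem_nhds]
  have := target_mem_nhdsWithin hy
  rwa [nhdsWithin_eq_nhds.2 (halfSpace_mem_nhds hy0)] at this

/-- The Laplacian may be computed in any chart. -/
lemma laplace_gram_inChart (hv : ContMDiff (𝓡∂ n) 𝓘(ℝ, ℝ) ∞ v) {p : M}
    {y : EuclideanSpace ℝ (Fin n)} (hy : y ∈ (extChartAt (𝓡∂ n) p).target) (hy0 : 0 < y 0) :
    laplace (gram g p) (inChart v p) y =
      laplaceBeltrami g v ((extChartAt (𝓡∂ n) p).symm y) := by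
  set x := (extChartAt (𝓡∂ n) p).symm y with hx
  have hxp : x ∈ (extChartAt (𝓡∂ n) p).source := (extChartAt (𝓡∂ n) p).map_target hy
  have hz : 0 < (coord x : EuclideanSpace ℝ (Fin n)) 0 :=
    coord_pos_of_isInteriorPoint (isInteriorPoint_symm hy hy0)
  set T : EuclideanSpace ℝ (Fin n) → EuclideanSpace ℝ (Fin n) := fun z =>
    extChartAt (𝓡∂ n) p ((extChartAt (𝓡∂ n) x).symm z) with hT
  have hTz : T (coord x) = y := by
    simp only [hT, symm_coord]
    exact (extChartAt (𝓡∂ n) p).right_inv hy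
  have hw := nhdsWithin_eq_nhds.2 (halfSpace_mem_nhds hz)
  have hsrc : ∀ᶠ z in 𝓝 (coord x : EuclideanSpace ℝ (Fin n)),
      z ∈ ((extChartAt (𝓡∂ n) x).symm ≫ extChartAt (𝓡∂ n) p).source := by
    have h1 := target_mem_nhdsWithin (coord_mem_target (n := n) x)
    have h2 := (tendsto_symm_coord (n := n) x).eventually (extChartAt_source_mem_nhds' hxp)
    rw [hw] at h1 h2
    filter_upwards [h1, h2] with z a b
    rw [PartialEquiv.trans_source, PartialEquiv.symm_source]
    exact ⟨a, b⟩
  have hTs : ∀ᶠ z in 𝓝 (coord x : EuclideanSpace ℝ (Fin n)), ContDiffAt ℝ ∞ T z := by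
    filter_upwards [hsrc, eventually_pos hz] with z a b
    have := contDiffWithinAt_ext_coord_change (I := 𝓡∂ n) (n := ∞) p x a
    rw [range_model] at this
    exact this.contDiffAt (halfSpace_mem_nhds b)
  have hy' : T (coord x) ∈ (extChartAt (𝓡∂ n) p).target := hTz ▸ hy
  have key := laplace_comp (T := T) (f := inChart v p) (metricNear_gram g hy')
    (metricNear_gram g (coord_mem_target x)) (smoothNear_inChart hv hy') hTs hz
    (by rwa [hTz]) (hsrc.mono fun z hz' i j => gram_eq_pullback g hz' i j)
  rw [hTz] at key
  rw [← key]
  refine laplace_congr hz.le ?_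
  rw [hw]
  filter_upwards [hsrc] with z a
  rw [PartialEquiv.trans_source] at a
  simp only [inChart, hT]
  rw [(extChartAt (𝓡∂ n) p).left_inv a.2]

/-- The smooth function `v` has nonnegative positive Laplacian, which is positive where `v ≠ 0`, and
its outward normal derivative is positive at the boundary points with `v ≠ 0` and zero at those with
`v = 0`. No sign of `v` is assumed. -/
structure StrictlySuperharmonic (g : Metric n M) (v : M → ℝ) : Prop where
  smooth : ContMDiff (𝓡∂ n) 𝓘(ℝ, ℝ) ∞ v
  laplace_nonneg : ∀ x, 0 ≤ laplaceBeltrami g v x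
  laplace_pos : ∀ x, v x ≠ 0 → 0 < laplaceBeltrami g v x
  normalDeriv_pos : ∀ x : Bdry n M, v x ≠ 0 → 0 < outwardNormalDeriv g v x
  normalDeriv_eq_zero : ∀ x : Bdry n M, v x = 0 → outwardNormalDeriv g v x = 0

variable {g}

namespace StrictlySuperharmonic

lemma eq_zero_of_isLocalMin (h : StrictlySuperharmonic g v) {x : M} (hx : IsLocalMin v x) :
    v x = 0 := by
  by_contra hne
  have hG := metricNear_gram g (coord_mem_target x)
  have hs := smoothNear_inChart h.smooth (coord_mem_target (n := n) x)
  have hmin := isLocalMinOn_inChart (n := n) hx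
  rcases (𝓡∂ n).isInteriorPoint_or_isBoundaryPoint x with hi | hb
  · have hpos := coord_pos_of_isInteriorPoint hi
    exact (h.laplace_pos x hne).not_ge
      (hG.laplace_nonpos hs hpos (hmin.isLocalMin (halfSpace_mem_nhds hpos)))
  · exact (h.normalDeriv_pos ⟨x, hb⟩ hne).not_ge
      (hG.normalDeriv_nonpos hs (coord_eq_zero_of_mem_bdry hb) hmin)

lemma nonneg [CompactSpace M] (h : StrictlySuperharmonic g v) (x : M) : 0 ≤ v x := by
  obtain ⟨x₀, -, hmin⟩ := isCompact_univ.exists_isMinOn ⟨x, Set.mem_univ x⟩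
    h.smooth.continuous.continuousOn
  have h0 := h.eq_zero_of_isLocalMin (hmin.isLocalMin Filter.univ_mem)
  exact h0 ▸ hmin (Set.mem_univ x)

/-- In a chart, the zeros of `v` in the open half-space form an open set. -/
lemma eventually_eq_zero_inChart (h : StrictlySuperharmonic g v) (hv0 : ∀ x, 0 ≤ v x) {p : M}
    {y : EuclideanSpace ℝ (Fin n)} (hy : y ∈ (extChartAt (𝓡∂ n) p).target) (hy0 : 0 < y 0)
    (hvy : inChart v p y = 0) : ∀ᶠ z in 𝓝 y, inChart v p z = 0 := by
  set F := inChart (n := n) v p with hF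
  have hF0 : ∀ z, 0 ≤ F z := fun z => hv0 _
  have hnh : (extChartAt (𝓡∂ n) p).target ∩ {z | 0 < z 0} ∈ 𝓝 y := by
    have := target_mem_nhdsWithin hy
    rw [nhdsWithin_eq_nhds.2 (halfSpace_mem_nhds hy0)] at this
    exact Filter.inter_mem this (eventually_pos hy0)
  obtain ⟨δ, hδ, hball⟩ := Metric.mem_nhds_iff.1 hnh
  rw [Metric.eventually_nhds_iff]
  refine ⟨δ / 2, by positivity, fun q hq => ?_⟩
  -- if `F q ≠ 0` for some `q` near `y`, Hopf's lemma applies to the largest ball around `q` in which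
  -- `F` is positive
  by_contra hFq
  -- `p'` is a zero of `F` closest to `q`
  set K := Metric.closedBall q (dist q y) with hK
  have hKball : K ⊆ Metric.ball y δ := fun z hz => by
    rw [Metric.mem_closedBall] at hz
    rw [Metric.mem_ball]
    linarith [dist_triangle z q y]
  have hsub : ∀ z ∈ K, z ∈ (extChartAt (𝓡∂ n) p).target ∧ 0 < z 0 := fun z hz =>
    hball (hKball hz)
  have hsm : ∀ z ∈ K, SmoothNear F z := fun z hz => smoothNear_inChart h.smooth (hsub z hz).1
  have hcont : ContinuousOn F K := fun z hz =>
    ((hsm z hz).continuousWithinAt (hsub z hz).2.le).mono fun x hx => (hsub x hx).2.le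
  have hZ : IsCompact (K ∩ F ⁻¹' {0}) :=
    (isCompact_closedBall q _).of_isClosed_subset
      (hcont.preimage_isClosed_of_isClosed Metric.isClosed_closedBall isClosed_singleton)
      Set.inter_subset_left
  have hyZ : y ∈ K ∩ F ⁻¹' {0} := ⟨by rw [hK, Metric.mem_closedBall, dist_comm], hvy⟩
  obtain ⟨p', hp', hmin⟩ := hZ.exists_isMinOn ⟨y, hyZ⟩
    (f := fun z => dist z q) (by fun_prop)
  have hFp' : F p' = 0 := hp'.2
  set r := dist p' q with hr
  have hrK : Metric.closedBall q r ⊆ K := Metric.closedBall_subset_closedBall hp'.1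
  have hr0 : 0 < r := by
    rw [hr, dist_pos]
    rintro rfl
    exact hFq hFp'
  have hbK : Metric.ball q r ⊆ K := Metric.ball_subset_closedBall.trans hrK
  obtain ⟨w, hw⟩ := hopf hr0 (fun z hz => (hsub z (hrK hz)).2.le) (fun z hz => (hsub z (hbK hz)).2)
    (fun z hz => metricNear_gram g (hsub z (hrK hz)).1) (fun z hz => hsm z (hrK hz))
    (fun z _ => hF0 z)
    (fun z hz => (hF0 z).lt_of_ne fun h0 =>
      absurd (hmin ⟨hbK hz, h0.symm⟩ : r ≤ dist z q) (not_le.2 (Metric.mem_ball.1 hz)))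
    (fun z hz => by
      rw [laplace_gram_inChart g h.smooth (hsub z (hbK hz)).1 (hsub z (hbK hz)).2]
      exact h.laplace_nonneg _)
    hr.symm hFp'
  have hp'0 := (hsub p' hp'.1).2
  have hlm : IsLocalMin F p' := Filter.Eventually.of_forall fun z => hFp' ▸ hF0 z
  refine hw ?_
  rw [fderivWithin_of_mem_nhds (halfSpace_mem_nhds hp'0), hlm.fderiv_eq_zero]
  rfl

/-- The strong maximum principle: the zeros of `v` form an open set. -/
lemma eventually_eq_zero (h : StrictlySuperharmonic g v) (hv0 : ∀ x, 0 ≤ v x) {p : M}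
    (hp : v p = 0) : ∀ᶠ x in 𝓝 p, v x = 0 := by
  set F := inChart (n := n) v p with hF
  set y₀ : EuclideanSpace ℝ (Fin n) := coord p with hy₀
  have hF0 : ∀ z, 0 ≤ F z := fun z => hv0 _
  have hFy₀ : F y₀ = 0 := by
    rw [hF, hy₀, inChart, symm_coord, hp]
  have hy₀H : y₀ ∈ halfSpace n := target_subset_halfSpace p (coord_mem_target p)
  have hy₀0 : 0 ≤ y₀ 0 := hy₀H
  obtain ⟨ρ, hρ, hball⟩ := Metric.mem_nhdsWithin_iff.1
    (target_mem_nhdsWithin (coord_mem_target (n := n) p))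
  set D : Set (EuclideanSpace ℝ (Fin n)) := Metric.ball y₀ ρ ∩ {z | 0 < z 0} with hD
  have hDH : D ⊆ halfSpace n := fun z hz => by
    have h0 : 0 < z 0 := hz.2
    exact h0.le
  have hDt : D ⊆ (extChartAt (𝓡∂ n) p).target := fun z hz => hball ⟨hz.1, hDH hz⟩
  have hopen : IsOpen {z : EuclideanSpace ℝ (Fin n) | 0 < z 0} :=
    isOpen_lt continuous_const (by fun_prop)
  have hconvex : Convex ℝ D := (convex_ball y₀ ρ).inter
    (convex_halfSpace_gt (EuclideanSpace.proj (0 : Fin n) :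
      EuclideanSpace ℝ (Fin n) →L[ℝ] ℝ).isLinear 0)
  have hsm : ∀ z ∈ (extChartAt (𝓡∂ n) p).target, SmoothNear F z := fun z hz =>
    smoothNear_inChart h.smooth hz
  have hcontD : ∀ z ∈ D, ContinuousAt F z := fun z hz =>
    ((hsm z (hDt hz)).continuousWithinAt (hDH hz)).continuousAt (halfSpace_mem_nhds hz.2)
  -- points of `D` that approximate a point of the half-ball
  have hup : ∀ z ∈ Metric.ball y₀ ρ ∩ halfSpace n, ∀ᶠ t in 𝓝[>] (0 : ℝ),
      z + t • coordVec 0 ∈ D := by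
    intro z hz
    have hc : Filter.Tendsto (fun t : ℝ => z + t • coordVec (n := n) 0) (𝓝 0) (𝓝 z) := by
      have : Continuous fun t : ℝ => z + t • coordVec (n := n) 0 := by fun_prop
      simpa using this.tendsto 0
    filter_upwards [(hc.eventually (Metric.isOpen_ball.mem_nhds hz.1)).filter_mono
      nhdsWithin_le_nhds, self_mem_nhdsWithin] with t ht ht0
    refine ⟨ht, ?_⟩
    have h1 : 0 ≤ z 0 := hz.2
    have h2 : (0 : ℝ) < t := ht0
    show 0 < (z + t • coordVec (n := n) 0) 0
    simp only [coordVec, PiLp.add_apply, PiLp.smul_apply, PiLp.single_apply, if_true,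
      smul_eq_mul, mul_one]
    linarith
  by_cases hpos : ∃ z ∈ D, 0 < F z
  · -- `F` is positive in `D`, so that `p` is a boundary point and Hopf's lemma applies there
    have hposD : ∀ z ∈ D, 0 < F z := by
      by_contra! hcon
      obtain ⟨z₁, hz₁D, hz₁⟩ := hcon
      have hU : IsOpen {z | z ∈ D ∧ 0 < F z} := by
        rw [isOpen_iff_mem_nhds]
        rintro z ⟨hz, hz'⟩
        filter_upwards [(Metric.isOpen_ball.inter hopen).mem_nhds hz,
          (hcontD z hz).eventually (lt_mem_nhds hz')] with x a b using ⟨a, b⟩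
      have hV : IsOpen {z | z ∈ D ∧ F z = 0} := by
        rw [isOpen_iff_mem_nhds]
        rintro z ⟨hz, hz'⟩
        filter_upwards [(Metric.isOpen_ball.inter hopen).mem_nhds hz,
          h.eventually_eq_zero_inChart hv0 (hDt hz) hz.2 hz'] with x a b using ⟨a, b⟩
      obtain ⟨z₂, hz₂D, hz₂⟩ := hpos
      obtain ⟨z, -, hz, hz'⟩ := hconvex.isPreconnected _ _ hU hV
        (fun z hz => ((hF0 z).lt_or_eq).imp (fun h => ⟨hz, h⟩) fun h => ⟨hz, h.symm⟩)
        ⟨z₂, hz₂D, hz₂D, hz₂⟩ ⟨z₁, hz₁D, hz₁D, le_antisymm hz₁ (hF0 z₁)⟩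
      exact hz.2.ne' hz'.2
    have hy₀z : y₀ 0 = 0 := by
      by_contra hne
      exact (hposD y₀ ⟨Metric.mem_ball_self hρ, lt_of_le_of_ne hy₀0 (Ne.symm hne)⟩).ne' hFy₀
    set r := ρ / 3 with hr
    have hr0 : 0 < r := by positivity
    set q := y₀ + r • coordVec (n := n) 0 with hq
    have hqy : dist y₀ q = r := by
      rw [hq, dist_self_add_right, norm_smul, coordVec]
      simp [abs_of_pos hr0]
    have hq0 : q 0 = r := by
      simp [hq, coordVec, hy₀z]
    have hcoord : ∀ z, q 0 - dist z q ≤ z 0 := fun z => by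
      have h1 : |(z - q) 0| ≤ ‖z - q‖ := PiLp.norm_apply_le (z - q) 0
      rw [← dist_eq_norm, PiLp.sub_apply] at h1
      linarith [(abs_le.1 h1).1]
    have hcb : ∀ z ∈ Metric.closedBall q r, z ∈ Metric.ball y₀ ρ ∩ halfSpace n := by
      intro z hz
      rw [Metric.mem_closedBall] at hz
      refine ⟨?_, ?_⟩
      · rw [Metric.mem_ball]
        have := dist_triangle z q y₀
        rw [dist_comm q y₀, hqy] at this
        linarith
      · show 0 ≤ z 0
        linarith [hcoord z]
    have hb : ∀ z ∈ Metric.ball q r, z ∈ D := by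
      intro z hz
      refine ⟨(hcb z (Metric.ball_subset_closedBall hz)).1, ?_⟩
      rw [Metric.mem_ball] at hz
      show 0 < z 0
      linarith [hcoord z]
    obtain ⟨w, hw⟩ := hopf hr0 (fun z hz => (hcb z hz).2) (fun z hz => (hb z hz).2)
      (fun z hz => metricNear_gram g (hball (hcb z hz))) (fun z hz => hsm z (hball (hcb z hz)))
      (fun z _ => hF0 z) (fun z hz => hposD z (hb z hz))
      (fun z hz => by
        rw [laplace_gram_inChart g h.smooth (hDt (hb z hz)) (hb z hz).2]
        exact h.laplace_nonneg _)
      hqy hFy₀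
    have hpb : p ∈ Bdry n M := mem_bdry_of_coord_eq_zero hy₀z
    have hlm : IsLocalMinOn F (halfSpace n) y₀ :=
      Filter.Eventually.of_forall fun z => hFy₀ ▸ hF0 z
    exact (hw ((metricNear_gram g (coord_mem_target p)).fderivWithin_eq_zero_of_normalDeriv_eq_zero
      (hsm _ (coord_mem_target p)) hy₀z hlm (h.normalDeriv_eq_zero ⟨p, hpb⟩ hp) w)).elim
  · -- `F` vanishes in `D`, hence by continuity in the half-ball
    have hzero : ∀ z ∈ Metric.ball y₀ ρ ∩ halfSpace n, F z = 0 := by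
      intro z hz
      have hcz : ContinuousWithinAt F (halfSpace n) z :=
        (hsm z (hball hz)).continuousWithinAt hz.2
      have hc : Filter.Tendsto (fun t : ℝ => z + t • coordVec (n := n) 0) (𝓝[>] 0)
          (𝓝[halfSpace n] z) := by
        refine tendsto_nhdsWithin_iff.2 ⟨?_, (hup z hz).mono fun t ht => hDH ht⟩
        have : Continuous fun t : ℝ => z + t • coordVec (n := n) 0 := by fun_prop
        have h0 := (this.tendsto 0).mono_left (nhdsWithin_le_nhds (s := Set.Ioi (0 : ℝ)))
        simpa using h0
      have h1 := hcz.tendsto.comp hc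
      have h2 : (F ∘ fun t : ℝ => z + t • coordVec (n := n) 0) =ᶠ[𝓝[>] 0] fun _ => 0 := by
        filter_upwards [hup z hz] with t ht
        by_contra hne
        exact hpos ⟨_, ht, (hF0 _).lt_of_ne (Ne.symm hne)⟩
      exact tendsto_nhds_unique (h1.congr' h2) tendsto_const_nhds
    have hcp : ContinuousAt (extChartAt (𝓡∂ n) p) p := continuousAt_extChartAt p
    filter_upwards [hcp.eventually (Metric.ball_mem_nhds y₀ hρ),
      extChartAt_source_mem_nhds (I := 𝓡∂ n) p] with x hx hxs
    have hxH : extChartAt (𝓡∂ n) p x ∈ halfSpace n :=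
      target_subset_halfSpace p ((extChartAt (𝓡∂ n) p).map_source hxs)
    have := hzero _ ⟨hx, hxH⟩
    rwa [hF, inChart, (extChartAt (𝓡∂ n) p).left_inv hxs] at this

/-- On a compact manifold, a strictly superharmonic function in the above sense vanishes. -/
lemma eq_zero [CompactSpace M] (h : StrictlySuperharmonic g v) (x : M) : v x = 0 := by
  by_contra hx
  have hcont := h.smooth.continuous
  have hopen : IsOpen {x | v x = 0} := isOpen_iff_mem_nhds.2 fun p hp =>
    h.eventually_eq_zero h.nonneg hp
  have hcomp : IsCompact {x | v x ≠ 0} := hopen.isClosed_compl.isCompact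
  obtain ⟨x₀, hx₀, hmin⟩ := hcomp.exists_isMinOn ⟨x, hx⟩ hcont.continuousOn
  have hnhds : {x | v x ≠ 0} ∈ 𝓝 x₀ := (isOpen_ne.preimage hcont).mem_nhds hx₀
  exact hx₀ (h.eq_zero_of_isLocalMin (hmin.isLocalMin hnhds))

end StrictlySuperharmonic

end MaximumPrinciple

/-! ### Obstruction to prescribing curvature in a conformal class -/

section Obstruction

variable {n : ℕ} [NeZero n] {M : Type*} [TopologicalSpace M]
  [ChartedSpace (EuclideanHalfSpace n) M] [IsManifold (𝓡∂ n) ∞ M]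

lemma mul_pos_of_sign_eq {a b : ℝ} (h : SignType.sign a = SignType.sign b) (hb : b ≠ 0) :
    0 < a * b := by
  rcases hb.lt_or_gt with hb | hb
  · rw [sign_neg hb, sign_eq_neg_one_iff] at h
    exact mul_pos_of_neg_of_neg h hb
  · rw [sign_pos hb, sign_eq_one_iff] at h
    exact mul_pos h hb

lemma gram_conformal {g g' : Metric n M} {w : M → ℝ}
    (hw : ∀ (x : M) (X Y : TangentSpace (𝓡∂ n) x),
      g'.inner x X Y = Real.exp (2 * w x) * g.inner x X Y) (x : M) :
    gram g' x = conformalMetric (inChart w x) (gram g x) := by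
  funext y
  ext i j
  exact hw _ _ _

/-- If the curvatures of `e^{2w} g` have the signs of `-s u`, then `s e^{-(n-2)w/2} u`, which lies
in the kernel for the metric `e^{2w} g`, is strictly superharmonic for this metric. -/
lemma strictlySuperharmonic_of_sign_eq (hn : 3 ≤ n) {g g' : Metric n M} {w u : SmoothFun n M}
    (hw : ∀ (x : M) (X Y : TangentSpace (𝓡∂ n) x),
      g'.inner x X Y = Real.exp (2 * w x) * g.inner x X Y)
    (hu : u ∈ robinKernel g) (s : ℝ)
    (hR : ∀ x, SignType.sign (scalarCurvature g' x) = SignType.sign (-s * u x))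
    (hh : ∀ x : Bdry n M, SignType.sign (meanCurvature g' x) = SignType.sign (-s * u x)) :
    StrictlySuperharmonic g' fun x => s * Real.exp (-(((n : ℝ) - 2) / 2) * w x) * u x := by
  set E : M → ℝ := fun x => Real.exp (-(((n : ℝ) - 2) / 2) * w x) with hE
  set v : M → ℝ := fun x => s * E x * u x with hv
  have hEpos : ∀ x, 0 < E x := fun x => Real.exp_pos _
  have hn3 : (3 : ℝ) ≤ n := by exact_mod_cast hn
  have hn2 : 0 < (n : ℝ) - 2 := by linarith
  have hn1 : 0 < (n : ℝ) - 1 := by linarith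
  have hc : ∀ (F : M → ℝ) (x : M), inChart (n := n) F x (coord x) = F x := fun F x => by
    rw [inChart, symm_coord]
  -- `v` solves the Robin problem for `g'`
  have hP : ∀ x, laplaceBeltrami g' v x =
      ((n : ℝ) - 2) / (4 * ((n : ℝ) - 1)) * E x * (scalarCurvature g' x * (-s * u x)) := by
    intro x
    have hx := coord_mem_target (n := n) x
    have key := (metricNear_gram g hx).conformalLaplacian_conformal (by omega)
      (smoothNear_inChart w.contMDiff hx) (smoothNear_inChart u.contMDiff hx)
      (target_subset_halfSpace x hx) s
    have h0 : laplace (gram g x) (inChart (n := n) u x) (coord x) +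
        ((n : ℝ) - 2) / (4 * ((n : ℝ) - 1)) *
        scalar (gram g x) (coord x) * inChart (n := n) u x (coord x) = 0 := by
      rw [hc u x]
      exact hu.1 x
    rw [h0, mul_zero, ← gram_conformal hw x, hc u x, hc w x] at key
    change laplaceBeltrami g' v x + ((n : ℝ) - 2) / (4 * ((n : ℝ) - 1)) *
      scalarCurvature g' x * v x = 0 at key
    rw [eq_neg_of_add_eq_zero_left key, hv]
    ring
  have hB : ∀ x : Bdry n M, outwardNormalDeriv g' v x =
      ((n : ℝ) - 2) / (2 * ((n : ℝ) - 1)) * E x * (meanCurvature g' x * (-s * u x)) := by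
    intro x
    have hx := coord_mem_target (n := n) x.1
    have key := (metricNear_gram g hx).robinOperator_conformal (by omega)
      (smoothNear_inChart w.contMDiff hx) (smoothNear_inChart u.contMDiff hx)
      (target_subset_halfSpace x.1 hx) s
    have h0 : normalDeriv (gram g x.1) (inChart (n := n) u x.1) (coord x.1) +
        ((n : ℝ) - 2) / (2 * ((n : ℝ) - 1)) *
        mean (gram g x.1) (coord x.1) * inChart (n := n) u x.1 (coord x.1) = 0 := by
      rw [hc u x.1]
      exact hu.2 x
    rw [h0, mul_zero, ← gram_conformal hw x.1, hc u x.1, hc w x.1] at key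
    change outwardNormalDeriv g' v x + ((n : ℝ) - 2) / (2 * ((n : ℝ) - 1)) *
      meanCurvature g' x * v x = 0 at key
    rw [eq_neg_of_add_eq_zero_left key, hv]
    ring
  have hne : ∀ {x}, v x ≠ 0 → -s * u x ≠ 0 := by
    intro x hx h0
    apply hx
    simp only [hv]
    linear_combination -(E x) * h0
  have heq : ∀ {x}, v x = 0 → -s * u x = 0 := by
    intro x hx
    have h1 : E x * (-s * u x) = 0 := by
      simp only [hv] at hx
      linear_combination -hx
    exact (mul_eq_zero.1 h1).resolve_left (hEpos x).ne'
  have hpos : ∀ x, v x ≠ 0 → 0 < laplaceBeltrami g' v x := by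
    intro x hx
    rw [hP]
    have := mul_pos_of_sign_eq (hR x) (hne hx)
    have := hEpos x
    positivity
  refine ⟨?_, fun x => ?_, hpos, fun x hx => ?_, fun x hx => ?_⟩
  · have h1 : ContMDiff (𝓡∂ n) 𝓘(ℝ, ℝ) ∞ E :=
      Real.contDiff_exp.comp_contMDiff ((contDiff_const.mul contDiff_id).comp_contMDiff w.contMDiff)
    exact (contMDiff_const.mul h1).mul u.contMDiff
  · by_cases hx : v x = 0
    · rw [hP, heq hx, mul_zero, mul_zero]
    · exact (hpos x hx).le
  · rw [hB]
    have := mul_pos_of_sign_eq (hh x) (hne hx)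
    have := hEpos x
    positivity
  · rw [hB, heq hx, mul_zero, mul_zero]

/-- The curvatures of a metric in the conformal class of `g` cannot have the signs of `-s u`; the
cases `s = -1` and `s = 1` are those of the same and of the opposite strict sign. -/
lemma not_sign_eq [CompactSpace M] (hn : 3 ≤ n) {g g' : Metric n M} (hg' : g' ∈ conformalClass g)
    {u : SmoothFun n M} (hu : u ∈ robinKernel g) (hu0 : u ≠ 0) {s : ℝ} (hs : s ≠ 0)
    (hR : ∀ x, SignType.sign (scalarCurvature g' x) = SignType.sign (-s * u x))
    (hh : ∀ x : Bdry n M, SignType.sign (meanCurvature g' x) = SignType.sign (-s * u x)) :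
    False := by
  obtain ⟨w, hw⟩ := hg'
  refine hu0 (ContMDiffMap.ext fun x => ?_)
  have := (strictlySuperharmonic_of_sign_eq hn hw hu s hR hh).eq_zero x
  simpa [hs, (Real.exp_pos _).ne'] using this

end Obstruction

end ConfBdry

end

theorem mainTheorem8 {n : ℕ} [NeZero n] (hn : 3 ≤ n)
    {M : Type*} [TopologicalSpace M] [ChartedSpace (EuclideanHalfSpace n) M]
    [IsManifold (𝓡∂ n) ∞ M] [T2Space M] [CompactSpace M]
    (g : ConfBdry.Metric n M) (u : ConfBdry.SmoothFun n M)
    (hu : u ∈ ConfBdry.robinKernel g) (hu0 : u ≠ 0) :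
    ConfBdry.withTrace u ∉ ConfBdry.curvatureMap '' ConfBdry.conformalClass g ∧
    ∀ (Q : M → ℝ) (f : ConfBdry.Bdry n M → ℝ),
      (ConfBdry.SameStrictSign (Q, f) (ConfBdry.withTrace u) ∨
        ConfBdry.OppositeStrictSign (Q, f) (ConfBdry.withTrace u)) →
      (Q, f) ∉ ConfBdry.curvatureMap '' ConfBdry.conformalClass g := by
  have main : ∀ (Q : M → ℝ) (f : ConfBdry.Bdry n M → ℝ),
      (ConfBdry.SameStrictSign (Q, f) (ConfBdry.withTrace u) ∨
        ConfBdry.OppositeStrictSign (Q, f) (ConfBdry.withTrace u)) →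
      (Q, f) ∉ ConfBdry.curvatureMap '' ConfBdry.conformalClass g := by
    rintro Q f hsign ⟨g', hg', heq⟩
    obtain ⟨rfl, rfl⟩ := Prod.mk.inj heq
    rcases hsign with ⟨hR, hh⟩ | ⟨hR, hh⟩
    · refine ConfBdry.not_sign_eq hn hg' hu hu0 (s := -1) (by norm_num) (fun x => ?_) fun x => ?_
      · simpa [ConfBdry.withTrace] using hR x
      · simpa [ConfBdry.withTrace] using hh x
    · refine ConfBdry.not_sign_eq hn hg' hu hu0 (s := 1) (by norm_num) (fun x => ?_) fun x => ?_
      · simpa [ConfBdry.withTrace] using hR x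
      · simpa [ConfBdry.withTrace] using hh x
  exact ⟨main _ _ (Or.inl ⟨fun _ => rfl, fun _ => rfl⟩), main⟩
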